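/- Let $K$ be a commutative ring and let $R$ be an infinite integral domain that is a $K$-algebra with injective structure map $K\to R$ (for instance: $K=\mathbb Z$ or $K$ any field, and $R=K[x_1,\dots,x_m]$ with $m\ge 1$; or $R=K$ when $K=\mathbb Z$ or $K$ is an infinite field). Let $b=(b_0,\dots,b_n)$ be nonnegative integers (Betti numbers) and $r=(r_1,\dots,r_n)$ nonnegative integers (rank conditions). Let $$\mathcal V(b)=\{(X_1,\dots,X_n) : X_i\in \mathrm{Mat}_{b_i\times b_{i-1}}(R),\ X_iX_{i-1}=0 \text{ for } 2\le i\le n\}$$ be the variety of complexes, and let $\mathcal V(b,r)=\{(X_1,\dots,X_n)\in\mathcal V(b): \operatorname{rank} X_i\le r_i \text{ for } 1\le i\le n\}$. Let $S=K[X(i)_{j,k}]$ be the polynomial ring in the entries of generic matrices $X(i)$ of size $b_i\times b_{i-1}$, $1\le i\le n$. For a set $V$ of points of $\prod_i \mathrm{Mat}_{b_i\times b_{i-1}}(R)$, let its coordinate ring $\mathscr O(V)$ be the quotient of $S$ by the ideal of all polynomials in $S$ vanishing at every point of $V$. Let $I(b)\subseteq S$ be the ideal generated by the entries of the products $X(i)X(i-1)$,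 $2\le i\le n$, and let $I(r)\subseteq S$ be the ideal generated by the $(r_i+1)$-minors of $X(i)$, $1\le i\le n$. Then there are isomorphisms of $K$-algebras 1. $\mathscr O(\mathcal V(b))\cong S/I(b)$, and 2. $\mathscr O(\mathcal V(b,r))\cong \mathscr O(\mathcal V(b))/I(r)\,\mathscr O(\mathcal V(b))$, each sending the class of a polynomial $p\in S$ to the class of $p$. -/

import Mathlib

/-- The coordinates on the space of `n`-tuples of matrices `X_1, …, X_n`, where `X_{k+1}`
(indexed here by `k : Fin n`) has size `b (k+1) × b k`. Only `b 0, …, b n` matter. -/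
abbrev EntryIndex (n : ℕ) (b : ℕ → ℕ) : Type :=
  Σ k : Fin n, Fin (b (k + 1)) × Fin (b k)

/-- The matrix of format `b (k+1) × b k` formed by the coordinates of the point `y`. -/
def entryMatrix {A : Type*} {n : ℕ} {b : ℕ → ℕ} (y : EntryIndex n b → A) (k : Fin n) :
    Matrix (Fin (b (k + 1))) (Fin (b k)) A :=
  Matrix.of fun i j => y ⟨k, i, j⟩

/-- The matrices of indeterminates. -/
noncomputable def genericMatrix (K : Type*) [CommRing K] (n : ℕ) (b : ℕ → ℕ) (k : Fin n) :
    Matrix (Fin (b (k + 1))) (Fin (b k)) (MvPolynomial (EntryIndex n b) K) :=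
  entryMatrix (fun v => MvPolynomial.X v) k

/-- The `R`-valued points of the variety of complexes: tuples of matrices over `R` in which
the product of any two consecutive ones vanishes. -/
def varietyOfComplexes (R : Type*) [CommRing R] (n : ℕ) (b : ℕ → ℕ) :
    Set (EntryIndex n b → R) :=
  {y | ∀ (k : ℕ) (h : k + 1 < n),
    entryMatrix y ⟨k + 1, h⟩ * entryMatrix y ⟨k, Nat.lt_of_succ_lt h⟩ = 0}

/-- The complexes whose `k`-th matrix has rank at most `r k`. -/
def rankVariety (R : Type*) [CommRing R] (n : ℕ) (b : ℕ → ℕ) (r : Fin n → ℕ) :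
    Set (EntryIndex n b → R) :=
  {y | y ∈ varietyOfComplexes R n b ∧ ∀ k : Fin n, (entryMatrix y k).rank ≤ r k}

/-- The ideal generated by the entries of the products of consecutive generic matrices. -/
noncomputable def complexIdeal (K : Type*) [CommRing K] (n : ℕ) (b : ℕ → ℕ) :
    Ideal (MvPolynomial (EntryIndex n b) K) :=
  Ideal.span {p | ∃ (k : ℕ) (h : k + 1 < n) (i : Fin (b (k + 1 + 1))) (j : Fin (b k)),
    p = (genericMatrix K n b ⟨k + 1, h⟩ *
      genericMatrix K n b ⟨k, Nat.lt_of_succ_lt h⟩) i j}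

/-- The ideal generated by the minors of order `r k + 1` of the `k`-th generic matrix,
for all `k`. -/
noncomputable def minorIdeal (K : Type*) [CommRing K] (n : ℕ) (b : ℕ → ℕ) (r : Fin n → ℕ) :
    Ideal (MvPolynomial (EntryIndex n b) K) :=
  Ideal.span {p | ∃ (k : Fin n) (s : Fin (r k + 1) ↪o Fin (b (k + 1)))
    (t : Fin (r k + 1) ↪o Fin (b k)), p = ((genericMatrix K n b k).submatrix s t).det}

/-- The ideal of all polynomials over `K` that vanish at every point of a set `V` of `R`-valued
points of affine space. -/
noncomputable def vanishingIdealOfPoints (K : Type*) {R σ : Type*} [CommRing K] [CommRing R]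
    [Algebra K R] (V : Set (σ → R)) : Ideal (MvPolynomial σ K) where
  carrier := {p | ∀ x ∈ V, MvPolynomial.aeval x p = 0}
  zero_mem' _ _ := map_zero _
  add_mem' {p q} hp hq x hx := by simp only [hp x hx, hq x hx, add_zero, map_add]
  smul_mem' p q hq x hx := by simp only [hq x hx, smul_eq_mul, mul_zero, map_mul]

/-- The coordinate ring over `K` of a set `V` of `R`-valued points of affine space:
polynomials over `K` modulo those vanishing at every point of `V`. -/
abbrev CoordinateRing (K : Type*) {R σ : Type*} [CommRing K] [CommRing R]
    [Algebra K R] (V : Set (σ → R)) : Type _ :=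
  MvPolynomial σ K ⧸ vanishingIdealOfPoints K V

/-!
The polynomials vanishing on the complexes with given rank conditions are determined by standard
monomial theory, over an arbitrary commutative ring of coefficients.

The polynomial ring is spanned over `K` by products of minors of the generic matrices. Such a
product is *standard* if the minors of each matrix form a chain for a partial order on minors, and
if for consecutive matrices the row sets of the minors of one matrix are dominated by the
complements of the column sets of the minors of the next one. A product of two incomparable minors
of one matrix can be rewritten in terms of minors of larger order or with smaller indices
(`MinorIndex.poly_mul_poly_mem`); a product of incompatible minors of two consecutive matrices can
be rewritten, modulo the entries of the product of these matrices, in terms of polynomials with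
larger row and column indices (`MinorIndex.poly_mul_poly_mem_of_adjacent`). Both relations come from
the Laplace expansion of a determinant with some entries replaced by zeros. Hence the standard
products span modulo the ideal of the complexes (`MinorIndex.standardSpan_eq_top`).

The standard products involving only minors of orders allowed by the rank conditions are linearly
independent as functions on the complexes in question
(`MinorIndex.eq_zero_of_linearCombination_mem_vanishingIdeal`). To see this, they are evaluated on
the family of complexes whose `k`-th matrix is `g (k + 1) * D k * (g k)⁻¹`, with generic lower
unitriangular matrices `g k` and with matrices `D k` that have variables on an initial piece of the
antidiagonal and zeros elsewhere. The leading term of a minor with row set `I` and column set `J`,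
in the variables of `D k`, has as coefficient the product of the minors of `g (k + 1)` with rows `I`
and of `g k` with rows the complement of `J`, both formed by the first columns; the second one
arises by Jacobi's identity for complementary minors of inverse matrices. The leading term of each
of these in the variables of the `g k` is the product of the diagonal entries. The resulting
exponents determine the standard product (`MinorIndex.Standard.eq_of_exponents_eq`), and all leading
coefficients are units, so that no field is needed. Since `R` is an infinite domain, a polynomial
vanishing on this family of points vanishes on the generic member.

A product with a minor of too large an order lies in the ideal of the minors. Writing a vanishing
polynomial in terms of standard products therefore shows that the vanishing ideal is the sum of the
ideal of the complexes and the ideal of the minors (`vanishingIdeal_rankVariety`). For rank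
conditions that hold automatically this gives the variety of complexes itself.
-/

open MvPolynomial

/-! ### Determinants and minors -/

/-- By Laplace expansion, a determinant vanishes if all the minors formed from some fixed rows
do. -/
theorem Matrix.det_eq_zero_of_rows_minors_eq_zero {ι A : Type*} [Fintype ι] [DecidableEq ι]
    [CommRing A] (N : Matrix ι ι A) {k : ℕ} (f : Fin k → ι) (hf : Function.Injective f)
    (h : ∀ g : Fin k → ι, (N.submatrix f g).det = 0) : N.det = 0 := by
  have hk : k ≤ Fintype.card ι := by simpa using Fintype.card_le_of_injective f hf
  induction hd : Fintype.card ι - k generalizing k with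
  | zero =>
    have hc : Fintype.card (Fin k) = Fintype.card ι := by rw [Fintype.card_fin]; omega
    have hb : Function.Bijective f := (Fintype.bijective_iff_injective_and_card f).2 ⟨hf, hc⟩
    have := h (Equiv.ofBijective f hb)
    rw [← Matrix.det_submatrix_equiv_self (Equiv.ofBijective f hb) N]
    exact this
  | succ d ih =>
    have hns : ¬ Function.Surjective f := fun hs => by
      have := Fintype.card_le_of_surjective f hs
      rw [Fintype.card_fin] at this
      omega
    obtain ⟨x, hx⟩ := not_forall.1 hns
    refine ih (Fin.cons x f) (Fin.cons_injective_iff.2 ⟨fun ⟨a, ha⟩ => hx ⟨a, ha⟩, hf⟩)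
      (fun g => ?_) (by omega) (by omega)
    rw [Matrix.det_succ_row_zero]
    refine Finset.sum_eq_zero fun j _ => ?_
    have : ((N.submatrix (Fin.cons x f) g).submatrix Fin.succ j.succAbove) =
        N.submatrix f (g ∘ j.succAbove) := by
      ext a b; simp
    rw [this, h, mul_zero]

/-- The terms of the Leibniz formula that belong to one left coset of the permutations preserving
the two blocks add up to a product of complementary minors. -/
theorem Matrix.sum_coset_det {α β A : Type*} [Fintype α] [Fintype β] [DecidableEq α]
    [DecidableEq β] [CommRing A] (N : Matrix (α ⊕ β) (α ⊕ β) A) (τ : Equiv.Perm (α ⊕ β)) :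
    ∑ ab : Equiv.Perm α × Equiv.Perm β,
      ((Equiv.Perm.sign (τ * Equiv.Perm.sumCongrHom α β ab) : ℤ) : A) *
        ∏ i, N ((τ * Equiv.Perm.sumCongrHom α β ab) i) i =
      ((Equiv.Perm.sign τ : ℤ) : A) * ((N.submatrix (τ ∘ Sum.inl) Sum.inl).det *
        (N.submatrix (τ ∘ Sum.inr) Sum.inr).det) := by
  rw [Matrix.det_apply', Matrix.det_apply', Finset.sum_mul_sum, Finset.mul_sum,
    Fintype.sum_prod_type]
  refine Finset.sum_congr rfl fun a _ => ?_
  rw [Finset.mul_sum]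
  refine Finset.sum_congr rfl fun b _ => ?_
  simp only [Equiv.Perm.sign_mul, Equiv.Perm.sumCongrHom_apply, Equiv.Perm.sign_sumCongr,
    Fintype.prod_sum_type, Equiv.Perm.coe_mul, Function.comp, Equiv.Perm.sumCongr_apply,
    Sum.map_inl, Sum.map_inr, Matrix.submatrix_apply]
  push_cast
  ring

/-- A weak form of Laplace expansion along the first block of columns. The determinant agrees with
the product of the determinants of the diagonal blocks up to products of complementary minors
whose rows have been exchanged between the blocks. -/
theorem Matrix.det_sub_mul_det_mem {α β A : Type*} [Fintype α] [Fintype β] [DecidableEq α]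
    [DecidableEq β] [CommRing A] (𝔞 : AddSubgroup A) (N : Matrix (α ⊕ β) (α ⊕ β) A)
    (h : ∀ τ : Equiv.Perm (α ⊕ β), (∃ a c, τ (Sum.inl a) = Sum.inr c) →
      (N.submatrix (τ ∘ Sum.inl) Sum.inl).det * (N.submatrix (τ ∘ Sum.inr) Sum.inr).det ∈ 𝔞) :
    N.det - (N.submatrix Sum.inl Sum.inl).det * (N.submatrix Sum.inr Sum.inr).det ∈ 𝔞 := by
  classical
  let H : Subgroup (Equiv.Perm (α ⊕ β)) := (Equiv.Perm.sumCongrHom α β).range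
  let D : Equiv.Perm (α ⊕ β) → A := fun τ =>
    ((Equiv.Perm.sign τ : ℤ) : A) * ((N.submatrix (τ ∘ Sum.inl) Sum.inl).det *
        (N.submatrix (τ ∘ Sum.inr) Sum.inr).det)
  let F : Equiv.Perm (α ⊕ β) → A := fun σ =>
    ((Equiv.Perm.sign σ : ℤ) : A) * ∏ i, N (σ i) i
  have hD : ∀ τ, D τ = ∑ x : H, F (τ * x) := fun τ => by
    rw [← (Equiv.ofBijective _
      (MonoidHom.ofInjective
        (Equiv.Perm.sumCongrHom_injective (α := α) (β := β))).bijective).sum_comp]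
    exact (Matrix.sum_coset_det N τ).symm
  have hdet : N.det = ∑ q : Equiv.Perm (α ⊕ β) ⧸ H, D q.out := by
    rw [Matrix.det_apply', ← Finset.sum_fiberwise Finset.univ
      (fun σ : Equiv.Perm (α ⊕ β) => (σ : Equiv.Perm (α ⊕ β) ⧸ H))]
    refine Finset.sum_congr rfl fun q _ => ?_
    rw [hD]
    symm
    refine Finset.sum_bij (fun x _ => q.out * (x : Equiv.Perm (α ⊕ β))) (fun x _ => ?_)
      (fun x _ y _ hxy => Subtype.ext (mul_left_cancel hxy)) (fun σ hσ => ?_) (fun x _ => rfl)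
    · rw [Finset.mem_filter]
      refine ⟨Finset.mem_univ _, ?_⟩
      rw [QuotientGroup.mk_mul_of_mem _ x.2, QuotientGroup.out_eq']
    · rw [Finset.mem_filter, ← QuotientGroup.out_eq' q, QuotientGroup.out_eq'] at hσ
      refine ⟨⟨q.out⁻¹ * σ, ?_⟩, Finset.mem_univ _, by simp⟩
      rw [← QuotientGroup.eq, hσ.2, QuotientGroup.out_eq']
  have h1 : D (Quotient.out ((1 : Equiv.Perm (α ⊕ β)) : Equiv.Perm (α ⊕ β) ⧸ H)) =
      (N.submatrix Sum.inl Sum.inl).det * (N.submatrix Sum.inr Sum.inr).det := by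
    obtain ⟨x, hx⟩ := QuotientGroup.mk_out_eq_mul H (1 : Equiv.Perm (α ⊕ β))
    rw [hx, one_mul, hD]
    rw [Fintype.sum_equiv (Equiv.mulLeft x) (fun y : H => F (x * y)) (fun y : H => F (1 * y))
      (fun y => by simp), ← hD]
    simp only [D, Equiv.Perm.sign_one, Units.val_one, Int.cast_one, one_mul]
    rfl
  rw [hdet, ← Finset.add_sum_erase _ _ (Finset.mem_univ
    ((1 : Equiv.Perm (α ⊕ β)) : Equiv.Perm (α ⊕ β) ⧸ H)), h1, add_sub_cancel_left]
  refine sum_mem fun q hq => ?_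
  have hq1 : q.out ∉ H := fun hmem => by
    apply Finset.ne_of_mem_erase hq
    rw [← QuotientGroup.out_eq' q]
    refine QuotientGroup.eq.2 ?_
    rw [mul_one]
    exact inv_mem hmem
  have hex : ∃ a c, q.out (Sum.inl a) = Sum.inr c := by
    by_contra hne
    push Not at hne
    apply hq1
    refine Equiv.Perm.mem_sumCongrHom_range_of_perm_mapsTo_inl ?_
    rintro _ ⟨a, rfl⟩
    cases hc : q.out (Sum.inl a) with
    | inl c => exact ⟨c, rfl⟩
    | inr c => exact absurd hc (hne a c)
  have := h q.out hex
  rcases Int.units_eq_one_or (Equiv.Perm.sign q.out) with hs | hs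
  · simpa [D, hs] using this
  · simpa [D, hs] using this

/-- The minor of `X` with row set `I` and column set `J`, both enumerated increasingly. -/
noncomputable def Matrix.minor {m n s : ℕ} {A : Type*} [CommRing A] (X : Matrix (Fin m) (Fin n) A)
    (I : Finset (Fin m)) (J : Finset (Fin n)) (hI : I.card = s) (hJ : J.card = s) : A :=
  (X.submatrix (I.orderEmbOfFin hI) (J.orderEmbOfFin hJ)).det

theorem exists_perm_orderEmbOfFin {m s : ℕ} (f : Fin s → Fin m) (hf : Function.Injective f)
    (I : Finset (Fin m)) (hI : I.card = s) (hfI : ∀ k, f k ∈ I) :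
    ∃ e : Equiv.Perm (Fin s), f = I.orderEmbOfFin hI ∘ e := by
  let f' : Fin s → I := fun k => ⟨f k, hfI k⟩
  have hf' : Function.Bijective f' := (Fintype.bijective_iff_injective_and_card f').2
    ⟨fun a b h => hf (congrArg Subtype.val h), by simp [hI]⟩
  refine ⟨(Equiv.ofBijective f' hf').trans (I.orderIsoOfFin hI).symm.toEquiv, ?_⟩
  ext k
  simp [f', ← Finset.coe_orderIsoOfFin_apply]

/-- A determinant formed from rows and columns of `X`, possibly repeated and in any order,
vanishes or is a minor up to sign. -/
theorem Matrix.det_submatrix_mem {m n s : ℕ} {A : Type*} [CommRing A]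
    (X : Matrix (Fin m) (Fin n) A) (f : Fin s → Fin m) (g : Fin s → Fin n) (𝔞 : Ideal A)
    (h : ∀ (hf : Function.Injective f) (hg : Function.Injective g),
      X.minor (Finset.univ.image f) (Finset.univ.image g)
        (by simpa using Finset.card_image_of_injective Finset.univ hf)
        (by simpa using Finset.card_image_of_injective Finset.univ hg) ∈ 𝔞) :
    (X.submatrix f g).det ∈ 𝔞 := by
  by_cases hf : Function.Injective f
  · by_cases hg : Function.Injective g
    · have hI : (Finset.univ.image f).card = s := by
        simpa using Finset.card_image_of_injective Finset.univ hf
      have hJ : (Finset.univ.image g).card = s := by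
        simpa using Finset.card_image_of_injective Finset.univ hg
      obtain ⟨e, he⟩ := exists_perm_orderEmbOfFin f hf _ hI (fun k => by simp)
      obtain ⟨e', he'⟩ := exists_perm_orderEmbOfFin g hg _ hJ (fun k => by simp)
      have h0 := h hf hg
      have : X.submatrix f g = ((X.submatrix ((Finset.univ.image f).orderEmbOfFin hI)
          ((Finset.univ.image g).orderEmbOfFin hJ)).submatrix e id).submatrix id e' := by
        ext a b
        simp only [Matrix.submatrix_apply, id]
        exact congrArg₂ X (congrFun he a) (congrFun he' b)
      rw [this, Matrix.det_permute', Matrix.det_permute]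
      exact Ideal.mul_mem_left _ _ (Ideal.mul_mem_left _ _ h0)
    · obtain ⟨a, b, hab, hne⟩ := Function.not_injective_iff.1 hg
      rw [Matrix.det_zero_of_column_eq hne (fun k => by simp [hab])]
      exact zero_mem _
  · obtain ⟨a, b, hab, hne⟩ := Function.not_injective_iff.1 hf
    rw [Matrix.det_zero_of_row_eq hne (by ext k; simp [hab])]
    exact zero_mem _

/-! ### Straightening in one matrix -/

/-- The number of elements of `I` below `z`. -/
def rankBelow {m : ℕ} (I : Finset (Fin m)) (z : ℕ) : ℕ :=
  (I.filter fun a : Fin m => (a : ℕ) < z).card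

theorem card_filter_orderEmbOfFin_lt {m s : ℕ} (I : Finset (Fin m)) (hI : I.card = s) (z : ℕ) :
    (Finset.univ.filter fun k : Fin s => (I.orderEmbOfFin hI k : ℕ) < z).card = rankBelow I z := by
  rw [rankBelow, ← Finset.card_map (I.orderEmbOfFin hI).toEmbedding]
  congr 1
  ext a
  simp only [Finset.mem_map, Finset.mem_filter, Finset.mem_univ, true_and]
  constructor
  · rintro ⟨k, hk, rfl⟩
    exact ⟨I.orderEmbOfFin_mem hI k, hk⟩
  · rintro ⟨ha, haz⟩
    have : a ∈ Set.range (I.orderEmbOfFin hI) := by rw [Finset.range_orderEmbOfFin]; exact ha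
    obtain ⟨k, rfl⟩ := this
    exact ⟨k, haz, rfl⟩

/-- If `S` arises from `T` by exchanging elements with value at least `z` for elements with value
less than `z`, then the sum of the values over `S` is smaller. -/
theorem Finset.sum_lt_sum_of_exchange {ι : Type*} [DecidableEq ι] (S T : Finset ι)
    (hc : S.card = T.card) (hne : S ≠ T) (v : ι → ℕ) (z : ℕ) (hS : ∀ x ∈ S, x ∉ T → v x < z)
    (hT : ∀ x ∈ T, x ∉ S → z ≤ v x) : ∑ x ∈ S, v x < ∑ x ∈ T, v x := by
  rw [← Finset.sum_inter_add_sum_sdiff S T, ← Finset.sum_inter_add_sum_sdiff T S,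
    Finset.inter_comm T S]
  have hcard : (S \ T).card = (T \ S).card := Finset.card_sdiff_comm hc
  have hpos : (S \ T).Nonempty := by
    rw [Finset.nonempty_iff_ne_empty, Ne, Finset.sdiff_eq_empty_iff_subset]
    exact fun h => hne (Finset.eq_of_subset_of_card_le h hc.ge)
  have h1 : ∑ x ∈ S \ T, v x < ∑ x ∈ S \ T, z :=
    Finset.sum_lt_sum_of_nonempty hpos fun x hx => by
      rw [Finset.mem_sdiff] at hx; exact hS x hx.1 hx.2
  have h2 : ∑ x ∈ T \ S, z ≤ ∑ x ∈ T \ S, v x :=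
    Finset.sum_le_sum fun x hx => by rw [Finset.mem_sdiff] at hx; exact hT x hx.1 hx.2
  simp only [Finset.sum_const, hcard] at h1 h2
  omega

/-- The masked matrix whose Laplace expansion straightens the product of the minors of `X` with
row sets `I`, `I'` and column sets `J`, `J'`. In the rows of `I` below `z` the columns `J'` are
replaced by zero, and in the rows of `I'` from `z` on the columns `J`. -/
noncomputable def garnirMatrix {m n s s' : ℕ} {A : Type*} [CommRing A]
    (X : Matrix (Fin m) (Fin n) A) (I : Fin s → Fin m) (J : Fin s → Fin n) (I' : Fin s' → Fin m)
    (J' : Fin s' → Fin n) (z : ℕ) : Matrix (Fin s ⊕ Fin s') (Fin s ⊕ Fin s') A :=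
  Matrix.fromBlocks (X.submatrix I J)
    (Matrix.of fun k l => if (I k : ℕ) < z then 0 else X (I k) (J' l))
    (Matrix.of fun k l => if (I' k : ℕ) < z then X (I' k) (J l) else 0) (X.submatrix I' J')

/-- If `I'` has more elements below `z` than `I`, then more than `s` rows of the masked matrix are
unmasked, so that its determinant lies in the ideal of the minors of order `s + 1`. -/
theorem garnirMatrix_det_mem {m n s s' : ℕ} {A : Type*} [CommRing A]
    (X : Matrix (Fin m) (Fin n) A) {I : Finset (Fin m)} {J : Finset (Fin n)} {I' : Finset (Fin m)}
    {J' : Finset (Fin n)} (hI : I.card = s) (hJ : J.card = s) (hI' : I'.card = s')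
    (hJ' : J'.card = s') (𝔞 : Ideal A)
    (hbig : ∀ (I₁ : Finset (Fin m)) (J₁ : Finset (Fin n)) (h₁ : I₁.card = s + 1)
      (h₂ : J₁.card = s + 1), X.minor I₁ J₁ h₁ h₂ ∈ 𝔞)
    (z : ℕ) (hz : rankBelow I z < rankBelow I' z) :
    (garnirMatrix X (I.orderEmbOfFin hI) (J.orderEmbOfFin hJ) (I'.orderEmbOfFin hI')
      (J'.orderEmbOfFin hJ') z).det ∈ 𝔞 := by
  classical
  set i := I.orderEmbOfFin hI
  set j := J.orderEmbOfFin hJ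
  set i' := I'.orderEmbOfFin hI'
  set j' := J'.orderEmbOfFin hJ'
  set N := garnirMatrix X i j i' j' z with hN
  let G : Finset (Fin s ⊕ Fin s') :=
    Finset.disjSum (Finset.univ.filter fun k => ¬ (i k : ℕ) < z)
      (Finset.univ.filter fun k => (i' k : ℕ) < z)
  have hG : s + 1 ≤ G.card := by
    have h1 : (Finset.univ.filter fun k => (i k : ℕ) < z).card = _ :=
      card_filter_orderEmbOfFin_lt I hI z
    have h2 : (Finset.univ.filter fun k => (i' k : ℕ) < z).card = _ :=
      card_filter_orderEmbOfFin_lt I' hI' z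
    have h3 := Finset.card_filter_add_card_filter_not (s := (Finset.univ : Finset (Fin s)))
      (fun k => (i k : ℕ) < z)
    rw [Finset.card_univ, Fintype.card_fin] at h3
    simp only [G, Finset.card_disjSum]
    omega
  obtain ⟨G', hG', hcard⟩ := Finset.exists_subset_card_eq hG
  let f : Fin (s + 1) → Fin s ⊕ Fin s' := fun k => ((G'.equivFinOfCardEq hcard).symm k : G')
  have hf : Function.Injective f := fun a b h =>
    (G'.equivFinOfCardEq hcard).symm.injective (Subtype.ext h)
  have hfG : ∀ k, f k ∈ G := fun k => hG' ((G'.equivFinOfCardEq hcard).symm k).2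
  rw [← Ideal.Quotient.eq_zero_iff_mem, RingHom.map_det]
  refine Matrix.det_eq_zero_of_rows_minors_eq_zero _ f hf fun g => ?_
  have hsub : ((Ideal.Quotient.mk 𝔞).mapMatrix N).submatrix f g =
      (Ideal.Quotient.mk 𝔞).mapMatrix (X.submatrix (Sum.elim i i' ∘ f) (Sum.elim j j' ∘ g)) := by
    ext a c
    simp only [RingHom.mapMatrix_apply, Matrix.submatrix_apply, Matrix.map_apply,
      Function.comp]
    congr 1
    have := hfG a
    rcases hfa : f a with k | k <;> rcases g c with l | l <;> rw [hfa] at this <;>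
      simp_all [G, garnirMatrix]
  rw [hsub, ← RingHom.map_det, Ideal.Quotient.eq_zero_iff_mem]
  exact Matrix.det_submatrix_mem _ _ _ _ fun _ _ => hbig _ _ _ _

/-- Straightening along rows. Modulo minors of larger order, a product of minors whose row sets
violate an inequality of the order is a combination of products in which the first factor has a
smaller row sum: these are the remaining terms of the Laplace expansion of the masked matrix. -/
theorem mul_minor_mem_of_rankBelow_lt {m n s s' : ℕ} {A : Type*} [CommRing A]
    (X : Matrix (Fin m) (Fin n) A) {I : Finset (Fin m)} {J : Finset (Fin n)} {I' : Finset (Fin m)}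
    {J' : Finset (Fin n)} (hI : I.card = s) (hJ : J.card = s) (hI' : I'.card = s')
    (hJ' : J'.card = s') (𝔞 : Ideal A)
    (hbig : ∀ (I₁ : Finset (Fin m)) (J₁ : Finset (Fin n)) (h₁ : I₁.card = s + 1)
      (h₂ : J₁.card = s + 1), X.minor I₁ J₁ h₁ h₂ ∈ 𝔞)
    (hrow : ∀ (I₁ : Finset (Fin m)) (h₁ : I₁.card = s), ∑ a ∈ I₁, (a : ℕ) < ∑ a ∈ I, (a : ℕ) →
      X.minor I₁ J h₁ hJ ∈ 𝔞)
    (z : ℕ) (hz : rankBelow I z < rankBelow I' z) :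
    X.minor I J hI hJ * X.minor I' J' hI' hJ' ∈ 𝔞 := by
  classical
  have h0 := garnirMatrix_det_mem X hI hJ hI' hJ' 𝔞 hbig z hz
  set i := I.orderEmbOfFin hI with hi
  set j := J.orderEmbOfFin hJ with hj
  set i' := I'.orderEmbOfFin hI'
  set j' := J'.orderEmbOfFin hJ'
  set N := garnirMatrix X i j i' j' z with hN
  have key := Matrix.det_sub_mul_det_mem 𝔞.toAddSubgroup N fun τ hτ => ?_
  · have := sub_mem h0 key
    rw [sub_sub_cancel] at this
    exact this
  obtain ⟨a₀, c₀, hac⟩ := hτ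
  change _ ∈ 𝔞
  -- A masked row moved to the opposite block contributes zero.
  by_cases h1 : ∃ a k, τ (Sum.inl a) = Sum.inr k ∧ ¬ (i' k : ℕ) < z
  · obtain ⟨a, k, hak, hk⟩ := h1
    rw [Matrix.det_eq_zero_of_row_eq_zero (A := N.submatrix (τ ∘ Sum.inl) Sum.inl) a
      (fun l => by
        simp only [Matrix.submatrix_apply, Function.comp, hak]
        simp [hN, garnirMatrix, hk]),
      zero_mul]
    exact zero_mem _
  by_cases h2 : ∃ a k, τ (Sum.inr a) = Sum.inl k ∧ (i k : ℕ) < z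
  · obtain ⟨a, k, hak, hk⟩ := h2
    rw [Matrix.det_eq_zero_of_row_eq_zero (A := N.submatrix (τ ∘ Sum.inr) Sum.inr) a
      (fun l => by
        simp only [Matrix.submatrix_apply, Function.comp, hak]
        simp [hN, garnirMatrix, hk]),
      mul_zero]
    exact zero_mem _
  push Not at h1 h2
  refine Ideal.mul_mem_right _ _ ?_
  have hsub : N.submatrix (τ ∘ Sum.inl) Sum.inl =
      X.submatrix (Sum.elim i i' ∘ τ ∘ Sum.inl) j := by
    ext a l
    simp only [Matrix.submatrix_apply, Function.comp]
    rcases h : τ (Sum.inl a) with k | k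
    · simp [hN, garnirMatrix]
    · simp [hN, garnirMatrix, h1 a k h]
  rw [hsub]
  refine Matrix.det_submatrix_mem _ _ _ _ fun hf hg => ?_
  have hJe : Finset.univ.image j = J := by
    rw [hj]; simp
  have hlt : ∑ a ∈ Finset.univ.image (Sum.elim i i' ∘ τ ∘ Sum.inl), (a : ℕ) <
      ∑ a ∈ I, (a : ℕ) := by
    rw [Finset.sum_image fun x _ y _ h => hf h]
    have e1 : ∑ a ∈ I, (a : ℕ) =
        ∑ x ∈ Finset.univ.map (Function.Embedding.inl : Fin s ↪ Fin s ⊕ Fin s'),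
          ((Sum.elim i i' x : Fin m) : ℕ) := by
      rw [Finset.sum_map, ← Finset.map_orderEmbOfFin_univ I hI, Finset.sum_map]
      rfl
    have e2 : ∑ x, (((Sum.elim i i' ∘ τ ∘ Sum.inl) x : Fin m) : ℕ) =
        ∑ x ∈ Finset.univ.map ((Function.Embedding.inl : Fin s ↪ Fin s ⊕ Fin s').trans
          τ.toEmbedding), ((Sum.elim i i' x : Fin m) : ℕ) := by
      rw [Finset.sum_map]
      rfl
    rw [e1, e2]
    refine Finset.sum_lt_sum_of_exchange _ _ (by simp) ?_ _ z ?_ ?_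
    · intro h
      have : τ (Sum.inl a₀) ∈
          Finset.univ.map (Function.Embedding.inl : Fin s ↪ Fin s ⊕ Fin s') := by
        rw [← h]; simp
      rw [hac] at this
      simp at this
    · intro x hx hx'
      obtain ⟨a, -, rfl⟩ := Finset.mem_map.1 hx
      rcases h : τ (Sum.inl a) with k | k
      · simp [h] at hx'
      · simpa [h] using h1 a k h
    · intro x hx hx'
      obtain ⟨k, -, rfl⟩ := Finset.mem_map.1 hx
      rcases h : τ.symm (Sum.inl k) with a | a
      · exact absurd (Finset.mem_map.2 ⟨a, Finset.mem_univ _, by simp [← h]⟩) hx'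
      · have := h2 a k (by simp [← h])
        simpa using this
  have := hrow (Finset.univ.image (Sum.elim i i' ∘ τ ∘ Sum.inl))
    (by simpa using Finset.card_image_of_injective Finset.univ hf) hlt
  simpa only [hJe] using this

theorem Matrix.minor_transpose {m n s : ℕ} {A : Type*} [CommRing A] (X : Matrix (Fin m) (Fin n) A)
    (I : Finset (Fin m)) (J : Finset (Fin n)) (hI : I.card = s) (hJ : J.card = s) :
    X.transpose.minor J I hJ hI = X.minor I J hI hJ := by
  rw [Matrix.minor, Matrix.minor, ← Matrix.det_transpose]
  rfl

theorem rankBelow_univ (m z : ℕ) : rankBelow (Finset.univ : Finset (Fin m)) z = min z m := by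
  rw [rankBelow, Fin.card_filter_val_lt]
  omega

theorem rankBelow_add_compl {m : ℕ} (J : Finset (Fin m)) (z : ℕ) :
    rankBelow J z + rankBelow Jᶜ z = min z m := by
  rw [← rankBelow_univ, rankBelow, rankBelow, rankBelow, ← Finset.card_union_of_disjoint,
    ← Finset.filter_union, Finset.union_compl]
  exact Finset.disjoint_filter_filter disjoint_compl_right

/-! ### Straightening in two consecutive matrices -/

/-- The square matrix with rows `X (κ v)` for `v ∈ J`, and rows of the identity elsewhere. -/
def completedRows {p m : ℕ} {A : Type*} [CommRing A] (X : Matrix (Fin p) (Fin m) A)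
    (J : Finset (Fin m)) (κ : J → Fin p) : Matrix (Fin m) (Fin m) A :=
  Matrix.of fun v u => if h : v ∈ J then X (κ ⟨v, h⟩) u else (1 : Matrix (Fin m) (Fin m) A) v u

theorem completedRows_det {p m s : ℕ} {A : Type*} [CommRing A] (X : Matrix (Fin p) (Fin m) A)
    {K : Finset (Fin p)} {J : Finset (Fin m)} (hK : K.card = s) (hJ : J.card = s) :
    (completedRows X J fun v => K.orderEmbOfFin hK ((J.orderIsoOfFin hJ).symm v)).det =
      X.minor K J hK hJ := by
  classical
  rw [← Matrix.det_submatrix_equiv_self (Equiv.sumCompl (· ∈ J))]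
  have : (completedRows X J fun v => K.orderEmbOfFin hK ((J.orderIsoOfFin hJ).symm v)).submatrix
      (Equiv.sumCompl (· ∈ J)) (Equiv.sumCompl (· ∈ J)) =
      Matrix.fromBlocks
        (X.submatrix (fun v : J => K.orderEmbOfFin hK ((J.orderIsoOfFin hJ).symm v)) Subtype.val)
        (X.submatrix (fun v : J => K.orderEmbOfFin hK ((J.orderIsoOfFin hJ).symm v)) Subtype.val)
        0 1 := by
    ext (a | a) (c | c)
    · simp [completedRows]
    · simp [completedRows]
    · have : (a : Fin m) ≠ c := fun h => a.2 (h ▸ c.2)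
      simp [completedRows, a.2, Matrix.one_apply, this]
    · simp [completedRows, a.2, Matrix.one_apply, Subtype.ext_iff]
  rw [this, Matrix.det_fromBlocks_zero₂₁, Matrix.det_one, mul_one, Matrix.minor,
    ← Matrix.det_submatrix_equiv_self (J.orderIsoOfFin hJ).toEquiv]
  congr 1
  ext a c
  simp

/-- The masked matrix whose Laplace expansion straightens the product of a minor of `X'` with
column set `J'` and a minor of `X` with rows `i` and columns `j`, when `X' * X = 0`. The last rows
carry copies of the unit vectors of the rows of the second minor below `z`, and the rows outside
`J'` from `z` on carry entries of `X`. -/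
noncomputable def mixedMatrix {p m q t : ℕ} {A : Type*} [CommRing A] (X' : Matrix (Fin p) (Fin m) A)
    (X : Matrix (Fin m) (Fin q) A) (J' : Finset (Fin m)) (κ : J' → Fin p) (i : Fin t → Fin m)
    (j : Fin t → Fin q) (z : ℕ) : Matrix (Fin m ⊕ Fin t) (Fin m ⊕ Fin t) A :=
  Matrix.fromBlocks (completedRows X' J' κ)
    (Matrix.of fun v l => if v ∈ J' ∨ (v : ℕ) < z then 0 else X v (j l))
    (Matrix.of fun x u => if (i x : ℕ) < z ∧ i x = u then 1 else 0)
    (X.submatrix i j)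

/-- If `X' * X = 0`, then subtracting the first columns times `X` from the last ones leaves fewer
than `t` nonzero rows in the last `t` columns. -/
theorem mixedMatrix_det_eq_zero {p m q t : ℕ} {A : Type*} [CommRing A]
    (X' : Matrix (Fin p) (Fin m) A) (X : Matrix (Fin m) (Fin q) A) (hX : X' * X = 0)
    (J' : Finset (Fin m)) (κ : J' → Fin p) {I : Finset (Fin m)} (hI : I.card = t)
    (j : Fin t → Fin q) (z : ℕ) (hz : z < rankBelow I z + rankBelow J' z) :
    (mixedMatrix X' X J' κ (I.orderEmbOfFin hI) j z).det = 0 := by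
  classical
  set i := I.orderEmbOfFin hI
  set N := mixedMatrix X' X J' κ i j z with hN
  let E : Matrix (Fin m ⊕ Fin t) (Fin m ⊕ Fin t) A :=
    Matrix.fromBlocks 1 (-X.submatrix id j) 0 1
  have hE : E.det = 1 := by simp [E]
  have hNE : N.det = (N * E).det := by rw [Matrix.det_mul, hE, mul_one]
  let G : Finset (Fin m ⊕ Fin t) :=
    Finset.disjSum (J'ᶜ.filter fun v : Fin m => (v : ℕ) < z)
      (Finset.univ.filter fun k : Fin t => ¬ (i k : ℕ) < z)
  have hG : G.card < t := by
    have h1 : (Finset.univ.filter fun k : Fin t => (i k : ℕ) < z).card = _ :=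
      card_filter_orderEmbOfFin_lt I hI z
    have h3 := Finset.card_filter_add_card_filter_not (s := (Finset.univ : Finset (Fin t)))
      (fun k => (i k : ℕ) < z)
    rw [Finset.card_univ, Fintype.card_fin] at h3
    have h4 := rankBelow_add_compl J' z
    have h5 : (J'ᶜ.filter fun v : Fin m => (v : ℕ) < z).card = rankBelow J'ᶜ z := rfl
    simp only [G, Finset.card_disjSum]
    omega
  have hzero : ∀ r, r ∉ G → ∀ l, (N * E) r (Sum.inr l) = 0 := by
    intro r hr l
    rw [hN, mixedMatrix, Matrix.fromBlocks_multiply]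
    rcases r with v | x
    · simp only [Matrix.fromBlocks_apply₁₂, Matrix.add_apply, Matrix.mul_neg, Matrix.neg_apply,
        Matrix.mul_one, Matrix.of_apply]
      by_cases hv : v ∈ J'
      · have : (completedRows X' J' κ * X.submatrix id j) v l = (X' * X) (κ ⟨v, hv⟩) (j l) := by
          simp [Matrix.mul_apply, completedRows, hv]
        rw [this, hX]
        simp [hv]
      · have : (completedRows X' J' κ * X.submatrix id j) v l = X v (j l) := by
          simp [Matrix.mul_apply, completedRows, hv, Matrix.one_apply]
        have hvz : ¬ (v : ℕ) < z := by simpa [G, hv] using hr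
        rw [this]
        simp [hv, hvz]
    · have hx : (i x : ℕ) < z := by simpa [G] using hr
      simp [Matrix.mul_apply, hx]
  rw [hNE, ← Matrix.det_transpose]
  refine Matrix.det_eq_zero_of_rows_minors_eq_zero _ Sum.inr Sum.inr_injective fun g => ?_
  by_cases hg : Function.Injective g
  · have : ∃ a, g a ∉ G := by
      by_contra h
      push Not at h
      have := Finset.card_le_card_of_injOn g (fun a _ => h a)
        (hg.injOn (s := (Finset.univ : Finset (Fin t))))
      rw [Finset.card_univ, Fintype.card_fin] at this
      omega
    obtain ⟨a, ha⟩ := this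
    exact Matrix.det_eq_zero_of_column_eq_zero a fun l => hzero _ ha l
  · obtain ⟨a, b, hab, hne⟩ := Function.not_injective_iff.1 hg
    exact Matrix.det_zero_of_column_eq hne fun k => by simp [hab]

/-- The determinant of a matrix whose entries have weights of the form `α r + β c` is weighted
homogeneous. -/
theorem MvPolynomial.isWeightedHomogeneous_det {σ K M ι : Type*} [CommRing K] [AddCommMonoid M]
    [Fintype ι] [DecidableEq ι] (w : σ → M) (N : Matrix ι ι (MvPolynomial σ K)) (α β : ι → M)
    (h : ∀ r c, IsWeightedHomogeneous w (N r c) (α r + β c)) :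
    IsWeightedHomogeneous w N.det (∑ r, α r + ∑ c, β c) := by
  rw [Matrix.det_apply]
  refine IsWeightedHomogeneous.sum _ _ _ fun τ _ => ?_
  have : IsWeightedHomogeneous w (∏ c, N (τ c) c) (∑ r, α r + ∑ c, β c) := by
    rw [← Equiv.sum_comp τ α, ← Finset.sum_add_distrib]
    exact IsWeightedHomogeneous.prod _ _ _ fun c _ => h _ _
  rcases Int.units_eq_one_or (Equiv.Perm.sign τ) with hs | hs
  · simpa [hs] using this
  · simpa [hs] using this.neg

theorem sum_orderEmbOfFin {m s : ℕ} {M : Type*} [AddCommMonoid M] (I : Finset (Fin m))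
    (hI : I.card = s) (f : Fin m → M) : ∑ k, f (I.orderEmbOfFin hI k) = ∑ a ∈ I, f a := by
  conv_rhs => rw [← Finset.map_orderEmbOfFin_univ I hI, Finset.sum_map]
  rfl

/-- Straightening of a product of minors of two consecutive matrices whose product vanishes modulo
`𝔞`. When the rows `I` and the columns `J'` have more than `z` elements below `z` in total, the
product of the minors reduces modulo `𝔞` to polynomials of the same degree and larger content. The
remaining terms of the Laplace expansion are products of determinants of homogeneous matrices, and
need not be identified any further. -/
theorem mixed_mul_minor_mem {σ K : Type*} [CommRing K] (w : σ → ℤ × ℤ) {p m q s t : ℕ}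
    (X' : Matrix (Fin p) (Fin m) (MvPolynomial σ K)) (X : Matrix (Fin m) (Fin q) (MvPolynomial σ K))
    (hX' : ∀ a v, IsWeightedHomogeneous w (X' a v) (1, (a : ℤ) + (v : ℤ)))
    (hX : ∀ v c, IsWeightedHomogeneous w (X v c) (1, (v : ℤ) + (c : ℤ)))
    (𝔞 : Ideal (MvPolynomial σ K)) (h𝔞 : ∀ a c, (X' * X) a c ∈ 𝔞)
    {R : Finset (Fin p)} {J' I : Finset (Fin m)} {J : Finset (Fin q)} (hR : R.card = s)
    (hJ' : J'.card = s) (hI : I.card = t) (hJ : J.card = t) (z : ℕ)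
    (hz : z < rankBelow I z + rankBelow J' z) :
    X'.minor R J' hR hJ' * X.minor I J hI hJ ∈ 𝔞.restrictScalars K ⊔
      ⨆ (c : ℤ) (_ : ∑ a ∈ R, (a : ℤ) + ∑ a ∈ J', (a : ℤ) +
          (∑ a ∈ I, (a : ℤ) + ∑ a ∈ J, (a : ℤ)) < c),
        weightedHomogeneousSubmodule K w ((s + t : ℤ), c) := by
  classical
  set c₀ : ℤ := ∑ a ∈ R, (a : ℤ) + ∑ a ∈ J', (a : ℤ) + (∑ a ∈ I, (a : ℤ) + ∑ a ∈ J, (a : ℤ))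
  set 𝔟 : Submodule K (MvPolynomial σ K) := 𝔞.restrictScalars K ⊔
      ⨆ (c : ℤ) (_ : c₀ < c), weightedHomogeneousSubmodule K w ((s + t : ℤ), c)
  set i := I.orderEmbOfFin hI with hi
  set j := J.orderEmbOfFin hJ with hj
  let κ : J' → Fin p := fun v => R.orderEmbOfFin hR ((J'.orderIsoOfFin hJ').symm v)
  set N := mixedMatrix X' X J' κ i j z with hN
  have hdet : N.det ∈ 𝔟 := by
    refine Submodule.mem_sup_left ?_
    change N.det ∈ 𝔞
    rw [← Ideal.Quotient.eq_zero_iff_mem, RingHom.map_det]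
    have h0 : (X'.map (Ideal.Quotient.mk 𝔞)) * (X.map (Ideal.Quotient.mk 𝔞)) = 0 := by
      rw [← Matrix.map_mul]
      ext a c
      simpa using Ideal.Quotient.eq_zero_iff_mem.2 (h𝔞 a c)
    have h1 : (Ideal.Quotient.mk 𝔞).mapMatrix N =
        mixedMatrix (X'.map (Ideal.Quotient.mk 𝔞)) (X.map (Ideal.Quotient.mk 𝔞)) J' κ i j z := by
      ext (a | a) (c | c)
      · simp only [hN, mixedMatrix, completedRows, RingHom.mapMatrix_apply, Matrix.map_apply,
          Matrix.fromBlocks_apply₁₁, Matrix.of_apply, Matrix.one_apply]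
        split_ifs <;> simp
      · simp only [hN, mixedMatrix, RingHom.mapMatrix_apply, Matrix.map_apply,
          Matrix.fromBlocks_apply₁₂, Matrix.of_apply]
        split_ifs <;> simp
      · simp only [hN, mixedMatrix, RingHom.mapMatrix_apply, Matrix.map_apply,
          Matrix.fromBlocks_apply₂₁, Matrix.of_apply]
        split_ifs <;> simp
      · simp [hN, mixedMatrix]
    rw [h1]
    exact mixedMatrix_det_eq_zero _ _ h0 _ _ hI _ _ hz
  have key := Matrix.det_sub_mul_det_mem 𝔟.toAddSubgroup N fun τ hτ => ?_
  · have := sub_mem (S := AddSubgroup (MvPolynomial σ K)) (H := 𝔟.toAddSubgroup) hdet key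
    rw [sub_sub_cancel] at this
    have e1 : N.submatrix Sum.inl Sum.inl = completedRows X' J' κ := by ext; rfl
    have e2 : N.submatrix Sum.inr Sum.inr = X.submatrix i j := by ext; rfl
    rw [e1, e2, completedRows_det] at this
    exact this
  obtain ⟨a₀, c₁, hac⟩ := hτ
  change _ ∈ 𝔟
  -- A row of one block that is zero in the columns of the other one contributes zero there.
  by_cases h1 : ∃ x v, τ (Sum.inr x) = Sum.inl v ∧ (v ∈ J' ∨ (v : ℕ) < z)
  · obtain ⟨x, v, hxv, hv⟩ := h1
    rw [Matrix.det_eq_zero_of_row_eq_zero (A := N.submatrix (τ ∘ Sum.inr) Sum.inr) x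
      (fun l => by
        simp only [Matrix.submatrix_apply, Function.comp, hxv]
        simp [hN, mixedMatrix, hv]),
      mul_zero]
    exact zero_mem _
  by_cases h2 : ∃ v x, τ (Sum.inl v) = Sum.inr x ∧ ¬ (i x : ℕ) < z
  · obtain ⟨v, x, hvx, hx⟩ := h2
    rw [Matrix.det_eq_zero_of_row_eq_zero (A := N.submatrix (τ ∘ Sum.inl) Sum.inl) v
      (fun l => by
        simp only [Matrix.submatrix_apply, Function.comp, hvx]
        simp [hN, mixedMatrix, hx]),
      zero_mul]
    exact zero_mem _
  push Not at h1 h2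
  -- The row index of each row, as a row of `X`.
  let val : Fin m ⊕ Fin t → ℕ := Sum.elim (fun v => (v : ℕ)) fun x => (i x : ℕ)
  -- The weights of the rows on the first columns. A column `u` has weight `u`, so a unit vector
  -- `e_v` has weight `-v`, which makes its entry homogeneous of weight zero.
  let α₁ : Fin m ⊕ Fin t → ℤ × ℤ := Sum.elim
    (fun v => if h : v ∈ J' then (1, (κ ⟨v, h⟩ : ℤ)) else (0, -(v : ℤ))) fun x => (0, -(i x : ℤ))
  have hone : IsWeightedHomogeneous w (1 : MvPolynomial σ K) ((0 : ℤ), (0 : ℤ)) :=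
    isWeightedHomogeneous_one K w
  have hw1 : IsWeightedHomogeneous w (N.submatrix (τ ∘ Sum.inl) Sum.inl).det
      (∑ v, α₁ (τ (Sum.inl v)) + ∑ u : Fin m, ((0 : ℤ), (u : ℤ))) := by
    refine isWeightedHomogeneous_det w _ (fun v => α₁ (τ (Sum.inl v)))
      (fun u => ((0 : ℤ), (u : ℤ))) fun r c => ?_
    simp only [Matrix.submatrix_apply, Function.comp]
    rcases τ (Sum.inl r) with v | x
    · by_cases hv : v ∈ J'
      · simpa [hN, mixedMatrix, completedRows, α₁, hv] using hX' (κ ⟨v, hv⟩) c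
      · by_cases hvc : v = c
        · subst hvc
          simpa [hN, mixedMatrix, completedRows, α₁, hv] using hone
        · simpa [hN, mixedMatrix, completedRows, α₁, hv, hvc] using isWeightedHomogeneous_zero K w _
    · by_cases hxc : (i x : ℕ) < z ∧ i x = c
      · have := hxc.1
        obtain ⟨-, rfl⟩ := hxc
        simpa [hN, mixedMatrix, α₁, this] using hone
      · simp only [hN, mixedMatrix, Matrix.fromBlocks_apply₂₁, Matrix.of_apply, if_neg hxc]
        exact isWeightedHomogeneous_zero K w _
  have hw2 : IsWeightedHomogeneous w (N.submatrix (τ ∘ Sum.inr) Sum.inr).det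
      (∑ x, ((1 : ℤ), (val (τ (Sum.inr x)) : ℤ)) + ∑ l : Fin t, ((0 : ℤ), (j l : ℤ))) := by
    refine isWeightedHomogeneous_det w _ (fun x => ((1 : ℤ), (val (τ (Sum.inr x)) : ℤ)))
      (fun l => ((0 : ℤ), (j l : ℤ))) fun r c => ?_
    simp only [Matrix.submatrix_apply, Function.comp]
    rcases h : τ (Sum.inr r) with v | x
    · have := h1 r v h
      simpa [hN, mixedMatrix, val, this.1, this.2, not_lt.2 this.2] using hX v (j c)
    · simpa [hN, mixedMatrix, val] using hX (i x) (j c)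
  have hsum : ∑ x ∈ I, (x : ℕ) < ∑ x, val (τ (Sum.inr x)) := by
    have e1 : ∑ a ∈ I, (a : ℕ) =
        ∑ x ∈ Finset.univ.map (Function.Embedding.inr : Fin t ↪ Fin m ⊕ Fin t), val x := by
      rw [Finset.sum_map, ← sum_orderEmbOfFin I hI]
      rfl
    have e2 : ∑ x, val (τ (Sum.inr x)) =
        ∑ x ∈ Finset.univ.map ((Function.Embedding.inr : Fin t ↪ Fin m ⊕ Fin t).trans
          τ.toEmbedding), val x := by
      rw [Finset.sum_map]
      rfl
    rw [e1, e2]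
    refine Finset.sum_lt_sum_of_exchange _ _ (by simp) ?_ _ z ?_ ?_
    · intro h
      have : τ (Sum.inl a₀) ∈
          Finset.univ.map ((Function.Embedding.inr : Fin t ↪ Fin m ⊕ Fin t).trans
            τ.toEmbedding) := by
        rw [← h, hac]; simp
      simp at this
    · intro x hx hx'
      obtain ⟨k, -, rfl⟩ := Finset.mem_map.1 hx
      rcases h : τ.symm (Sum.inr k) with a | a
      · have := h2 a k (by simp [← h])
        simpa [val] using this
      · exact absurd (Finset.mem_map.2 ⟨a, Finset.mem_univ _, by simp [← h]⟩) hx'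
    · intro x hx hx'
      obtain ⟨a, -, rfl⟩ := Finset.mem_map.1 hx
      rcases h : τ (Sum.inr a) with k | k
      · simpa [h, val] using (h1 a k h).2
      · simp [h] at hx'
  have hα : ∑ r, α₁ r = ((s : ℤ), ∑ a ∈ R, (a : ℤ) - ∑ a ∈ J'ᶜ, (a : ℤ) - ∑ a ∈ I, (a : ℤ)) := by
    rw [Fintype.sum_sum_type, ← Finset.sum_add_sum_compl J']
    have e1 : ∑ v ∈ J', α₁ (Sum.inl v) = ((s : ℤ), ∑ a ∈ R, (a : ℤ)) := by
      rw [← sum_orderEmbOfFin R hR (fun a => (a : ℤ)), ← Finset.sum_coe_sort,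
        ← (J'.orderIsoOfFin hJ').toEquiv.sum_comp]
      have : ∀ k : Fin s, α₁ (Sum.inl ((J'.orderIsoOfFin hJ').toEquiv k : J')) =
          (1, (R.orderEmbOfFin hR k : ℤ)) := fun k =>
        (dif_pos ((J'.orderIsoOfFin hJ').toEquiv k).2).trans
          (congrArg (fun l => ((1 : ℤ), (R.orderEmbOfFin hR l : ℤ)))
            ((J'.orderIsoOfFin hJ').symm_apply_apply k))
      rw [Finset.sum_congr rfl fun k _ => this k]
      ext <;> simp [Prod.fst_sum, Prod.snd_sum]
    have e2 : ∑ v ∈ J'ᶜ, α₁ (Sum.inl v) = ((0 : ℤ), -∑ a ∈ J'ᶜ, (a : ℤ)) := by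
      have : ∀ v ∈ J'ᶜ, α₁ (Sum.inl v) = (0, -(v : ℤ)) := fun v hv => by
        simp [α₁, Finset.mem_compl.1 hv]
      rw [Finset.sum_congr rfl this]
      ext <;> simp [Prod.fst_sum, Prod.snd_sum]
    have e3 : ∑ x, α₁ (Sum.inr x) = ((0 : ℤ), -∑ a ∈ I, (a : ℤ)) := by
      rw [← sum_orderEmbOfFin I hI (fun a => (a : ℤ))]
      ext <;> simp [Prod.fst_sum, Prod.snd_sum, α₁, hi]
    rw [e1, e2, e3]
    ext <;> simp; ring
  have hα' : ∑ v, α₁ (τ (Sum.inl v)) = ∑ r, α₁ r + ∑ x, ((0 : ℤ), (val (τ (Sum.inr x)) : ℤ)) := by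
    rw [← Equiv.sum_comp τ α₁, Fintype.sum_sum_type, add_assoc, ← Finset.sum_add_distrib]
    have : ∀ x, α₁ (τ (Sum.inr x)) + ((0 : ℤ), (val (τ (Sum.inr x)) : ℤ)) = 0 := fun x => by
      rcases h : τ (Sum.inr x) with v | y
      · simp [α₁, val, (h1 x v h).1]
      · simp [α₁, val]
    rw [Finset.sum_congr rfl fun x _ => this x]
    simp
  have hprod := hw1.mul hw2
  -- An exchange raises the sum of the row indices in the last block, and by the same amount the
  -- weight of the first block.
  refine Submodule.mem_sup_right (Submodule.mem_iSup_of_mem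
    (c₀ + 2 * ((∑ x, val (τ (Sum.inr x)) : ℕ) - (∑ x ∈ I, (x : ℕ) : ℕ) : ℤ))
    (Submodule.mem_iSup_of_mem (by omega) ?_))
  rw [mem_weightedHomogeneousSubmodule]
  convert hprod using 1
  rw [hα', hα]
  have hcomp := Finset.sum_add_sum_compl J' fun a : Fin m => (a : ℤ)
  have hJs := sum_orderEmbOfFin J hJ fun a : Fin q => (a : ℤ)
  ext
  · simp [Prod.fst_sum]
  · simp only [Prod.snd_sum, Prod.snd_add, c₀, hj, hJs, ← hcomp]
    push_cast
    ring

/-! ### The order on the minors -/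

/-- Straightening along columns. -/
theorem mul_minor_mem_of_rankBelow_lt_col {m n s s' : ℕ} {A : Type*} [CommRing A]
    (X : Matrix (Fin m) (Fin n) A) {I : Finset (Fin m)} {J : Finset (Fin n)} {I' : Finset (Fin m)}
    {J' : Finset (Fin n)} (hI : I.card = s) (hJ : J.card = s) (hI' : I'.card = s')
    (hJ' : J'.card = s') (𝔞 : Ideal A)
    (hbig : ∀ (I₁ : Finset (Fin m)) (J₁ : Finset (Fin n)) (h₁ : I₁.card = s + 1)
      (h₂ : J₁.card = s + 1), X.minor I₁ J₁ h₁ h₂ ∈ 𝔞)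
    (hcol : ∀ (J₁ : Finset (Fin n)) (h₁ : J₁.card = s), ∑ a ∈ J₁, (a : ℕ) < ∑ a ∈ J, (a : ℕ) →
      X.minor I J₁ hI h₁ ∈ 𝔞)
    (z : ℕ) (hz : rankBelow J z < rankBelow J' z) :
    X.minor I J hI hJ * X.minor I' J' hI' hJ' ∈ 𝔞 := by
  rw [← Matrix.minor_transpose X I, ← Matrix.minor_transpose X I']
  refine mul_minor_mem_of_rankBelow_lt X.transpose hJ hI hJ' hI' 𝔞 (fun I₁ J₁ h₁ h₂ => ?_)
    (fun J₁ h₁ h => ?_) z hz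
  · rw [Matrix.minor_transpose]
    exact hbig _ _ _ _
  · rw [Matrix.minor_transpose]
    exact hcol _ _ h

theorem Matrix.minor_congr {m n s t : ℕ} {A : Type*} [CommRing A] (X : Matrix (Fin m) (Fin n) A)
    {I : Finset (Fin m)} {J : Finset (Fin n)} (hI : I.card = s) (hJ : J.card = s)
    (hI' : I.card = t) (hJ' : J.card = t) : X.minor I J hI hJ = X.minor I J hI' hJ' := by
  subst hI
  subst hI'
  rfl

/-- The index of a nonempty minor of one of the matrices of a complex. -/
structure MinorIndex (n : ℕ) (b : ℕ → ℕ) where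
  /-- The position of the matrix. -/
  arrow : Fin n
  /-- The rows of the minor. -/
  rows : Finset (Fin (b (arrow + 1)))
  /-- The columns of the minor. -/
  cols : Finset (Fin (b arrow))
  card_cols : cols.card = rows.card
  rows_pos : 0 < rows.card

namespace MinorIndex

variable {n : ℕ} {b : ℕ → ℕ}

/-- The order of a minor. -/
def size (δ : MinorIndex n b) : ℕ := δ.rows.card

/-- The value of a minor at a point. -/
noncomputable def eval {A : Type*} [CommRing A] (δ : MinorIndex n b) (y : EntryIndex n b → A) : A :=
  (entryMatrix y δ.arrow).minor δ.rows δ.cols rfl δ.card_cols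

/-- A minor of the generic matrices, as a polynomial. -/
noncomputable def poly (K : Type*) [CommRing K] (δ : MinorIndex n b) :
    MvPolynomial (EntryIndex n b) K :=
  δ.eval fun v => X v

/-- The sum of the row indices and the column indices of a minor. -/
def content (δ : MinorIndex n b) : ℕ := ∑ a ∈ δ.rows, (a : ℕ) + ∑ a ∈ δ.cols, (a : ℕ)

/-- The partial order on the minors of each matrix for which the chains give the standard
bitableaux: minors of larger order and with smaller indices come first. It is given by
comparing, for each `z`, the numbers of row indices and of column indices below `z`. -/
instance : LE (MinorIndex n b) where
  le δ γ := δ.arrow = γ.arrow ∧ ∀ z,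
    rankBelow γ.rows z ≤ rankBelow δ.rows z ∧ rankBelow γ.cols z ≤ rankBelow δ.cols z

theorem le_def {δ γ : MinorIndex n b} : δ ≤ γ ↔ δ.arrow = γ.arrow ∧ ∀ z,
    rankBelow γ.rows z ≤ rankBelow δ.rows z ∧ rankBelow γ.cols z ≤ rankBelow δ.cols z := Iff.rfl

theorem le_refl (δ : MinorIndex n b) : δ ≤ δ :=
  ⟨rfl, fun _ => ⟨_root_.le_refl _, _root_.le_refl _⟩⟩

instance : Finite (MinorIndex n b) := by
  refine Finite.of_injective (β := Σ k : Fin n, Finset (Fin (b (k + 1))) × Finset (Fin (b k)))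
    (fun δ => ⟨δ.arrow, δ.rows, δ.cols⟩) ?_
  rintro ⟨k, I, J, h, h'⟩ ⟨k₁, I₁, J₁, h₁, h₁'⟩ heq
  simp only [Sigma.mk.injEq] at heq
  obtain ⟨rfl, heq⟩ := heq
  simp only [heq_eq_eq, Prod.mk.injEq] at heq
  obtain ⟨rfl, rfl⟩ := heq
  rfl

/-- A statistic which is smaller for minors of smaller order and, among minors of the same order,
for minors of larger content. -/
def height (δ : MinorIndex n b) : ℕ :=
  δ.size * (b (δ.arrow + 1) * b (δ.arrow + 1) + b δ.arrow * b δ.arrow + 1) - δ.content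

theorem _root_.Finset.sum_val_le {m : ℕ} (I : Finset (Fin m)) : ∑ a ∈ I, (a : ℕ) ≤ m * m :=
  calc ∑ a ∈ I, (a : ℕ) ≤ ∑ _a ∈ I, m := Finset.sum_le_sum fun a _ => a.2.le
    _ ≤ m * m := by
      rw [Finset.sum_const, smul_eq_mul]
      exact Nat.mul_le_mul_right _ (by simpa using Finset.card_le_univ I)

theorem content_le (δ : MinorIndex n b) :
    δ.content ≤ b (δ.arrow + 1) * b (δ.arrow + 1) + b δ.arrow * b δ.arrow :=
  add_le_add (Finset.sum_val_le _) (Finset.sum_val_le _)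

theorem height_lt_of_size_lt {δ ε : MinorIndex n b} (ha : ε.arrow = δ.arrow)
    (h : δ.size < ε.size) : δ.height < ε.height := by
  have h1 := content_le ε
  rw [height, height, ha] at *
  set M := b (δ.arrow + 1) * b (δ.arrow + 1) + b δ.arrow * b δ.arrow
  have : (δ.size + 1) * (M + 1) ≤ ε.size * (M + 1) := Nat.mul_le_mul_right _ h
  have h3 : (δ.size + 1) * (M + 1) = δ.size * (M + 1) + (M + 1) := by ring
  omega

theorem height_lt_of_content_lt {δ ε : MinorIndex n b} (ha : ε.arrow = δ.arrow)
    (hs : ε.size = δ.size) (h : ε.content < δ.content) : δ.height < ε.height := by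
  have h1 := content_le δ
  rw [height, height, ha, hs]
  set M := b (δ.arrow + 1) * b (δ.arrow + 1) + b δ.arrow * b δ.arrow
  have : 1 * (M + 1) ≤ δ.size * (M + 1) := Nat.mul_le_mul_right _ δ.rows_pos
  omega

/-- Straightening of a product of two minors of one matrix: if the first one does not precede the
second one, the product lies in the ideal of the minors of larger height. -/
theorem poly_mul_poly_mem {K : Type*} [CommRing K] {δ γ : MinorIndex n b}
    (ha : δ.arrow = γ.arrow) (hle : ¬ δ ≤ γ) :
    δ.poly K * γ.poly K ∈ Ideal.span (poly K '' {ε : MinorIndex n b | δ.height < ε.height}) := by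
  obtain ⟨k, I, J, hJ, hI⟩ := δ
  obtain ⟨k', I', J', hJ', hI'⟩ := γ
  obtain rfl : k = k' := ha
  have hbig : ∀ (I₁ : Finset (Fin (b (k + 1)))) (J₁ : Finset (Fin (b k)))
      (h₁ : I₁.card = I.card + 1) (h₂ : J₁.card = I.card + 1),
      (genericMatrix K n b k).minor I₁ J₁ h₁ h₂ ∈ Ideal.span (poly K ''
        {ε : MinorIndex n b | (⟨k, I, J, hJ, hI⟩ : MinorIndex n b).height < ε.height}) := by
    intro I₁ J₁ h₁ h₂
    let ε : MinorIndex n b := ⟨k, I₁, J₁, h₂.trans h₁.symm, by omega⟩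
    have he : ε.poly K = (genericMatrix K n b k).minor I₁ J₁ h₁ h₂ :=
      Matrix.minor_congr _ _ _ _ _
    rw [← he]
    refine Ideal.subset_span ⟨ε, height_lt_of_size_lt rfl ?_, rfl⟩
    simp only [size, ε]
    omega
  simp only [le_def, true_and, not_forall, not_and_or, not_le] at hle
  obtain ⟨z, hz | hz⟩ := hle
  · refine mul_minor_mem_of_rankBelow_lt _ rfl hJ rfl hJ' _ hbig (fun I₁ h₁ hlt => ?_) z hz
    let ε : MinorIndex n b := ⟨k, I₁, J, hJ.trans h₁.symm, by omega⟩
    have he : ε.poly K = (genericMatrix K n b k).minor I₁ J h₁ hJ :=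
      Matrix.minor_congr _ _ _ _ _
    change (genericMatrix K n b k).minor I₁ J h₁ hJ ∈ _
    rw [← he]
    refine Ideal.subset_span ⟨ε, height_lt_of_content_lt rfl h₁ ?_, rfl⟩
    simpa [content, ε] using hlt
  · refine mul_minor_mem_of_rankBelow_lt_col _ rfl hJ rfl hJ' _ hbig (fun J₁ h₁ hlt => ?_) z hz
    let ε : MinorIndex n b := ⟨k, I, J₁, h₁, hI⟩
    refine Ideal.subset_span ⟨ε, height_lt_of_content_lt rfl rfl ?_, rfl⟩
    simpa [content, ε] using hlt

end MinorIndex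

/-! ### Standard products of minors span -/

/-- A weighted homogeneous element of an ideal generated by weighted homogeneous elements is a
linear combination of multiples of the generators by monomials, all of the same weight. -/
theorem MvPolynomial.mem_span_monomial_mul_of_mem_ideal_span {σ K M ι : Type*} [CommRing K]
    [AddCommMonoid M] (w : σ → M) (s : Set ι) (g : ι → MvPolynomial σ K) (d : ι → M)
    (hg : ∀ i, IsWeightedHomogeneous w (g i) (d i)) {p : MvPolynomial σ K} {e : M}
    (hp : IsWeightedHomogeneous w p e) (hmem : p ∈ Ideal.span (g '' s)) :
    p ∈ Submodule.span K {q | ∃ (m : σ →₀ ℕ) (i : ι), i ∈ s ∧ Finsupp.weight w m + d i = e ∧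
      q = monomial m 1 * g i} := by
  classical
  have h1 : p ∈ Submodule.span K {q | ∃ (m : σ →₀ ℕ) (i : ι), i ∈ s ∧ q = monomial m 1 * g i} := by
    clear hp
    refine Submodule.span_induction (p := fun p _ => p ∈ Submodule.span K
      {q | ∃ (m : σ →₀ ℕ) (i : ι), i ∈ s ∧ q = monomial m 1 * g i}) ?_ (zero_mem _)
      (fun _ _ _ _ h h' => add_mem h h') ?_ hmem
    · rintro _ ⟨i, hi, rfl⟩
      exact Submodule.subset_span ⟨0, i, hi, by simp⟩
    · intro f x _ hx
      induction f using MvPolynomial.induction_on'' with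
      | C a => rw [smul_eq_mul, ← smul_eq_C_mul]; exact Submodule.smul_mem _ _ hx
      | monomial_add a c f _ _ h1 h2 =>
        rw [add_smul]
        exact add_mem h2 h1
      | mul_X f v h =>
        rw [mul_comm, mul_smul]
        refine Submodule.span_induction (p := fun y _ => (X v : MvPolynomial σ K) • y ∈
          Submodule.span K {q | ∃ (m : σ →₀ ℕ) (i : ι), i ∈ s ∧ q = monomial m 1 * g i}) ?_
          (by simp) (fun _ _ _ _ h h' => by rw [smul_add]; exact add_mem h h')
          (fun c y _ h => by rw [smul_comm]; exact Submodule.smul_mem _ _ h) h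
        rintro _ ⟨m, i, hi, rfl⟩
        refine Submodule.subset_span ⟨Finsupp.single v 1 + m, i, hi, ?_⟩
        rw [smul_eq_mul, ← mul_assoc, X, monomial_mul, one_mul]
  have h2 := Submodule.mem_map_of_mem (f := weightedHomogeneousComponent w e) h1
  rw [weightedHomogeneousComponent_eq_self hp, Submodule.map_span] at h2
  refine Submodule.span_le.2 ?_ h2
  rintro _ ⟨_, ⟨m, i, hi, rfl⟩, rfl⟩
  have hh : IsWeightedHomogeneous w (monomial m 1 * g i) (Finsupp.weight w m + d i) :=
    (isWeightedHomogeneous_monomial w m 1 rfl).mul (hg i)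
  rw [SetLike.mem_coe, weightedHomogeneousComponent_of_mem hh]
  split_ifs with h
  · exact Submodule.subset_span ⟨m, i, hi, h.symm, rfl⟩
  · exact zero_mem _

/-- The bidegree of a coordinate: its degree and the sum of its row and column indices. -/
def entryWeight {n : ℕ} {b : ℕ → ℕ} (v : EntryIndex n b) : ℤ × ℤ :=
  (1, (v.2.1 : ℤ) + (v.2.2 : ℤ))

namespace MinorIndex

variable {n : ℕ} {b : ℕ → ℕ}

/-- The bidegree of a minor. -/
def weight (δ : MinorIndex n b) : ℤ × ℤ := ((δ.size : ℤ), (δ.content : ℤ))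

theorem poly_isWeightedHomogeneous (K : Type*) [CommRing K] (δ : MinorIndex n b) :
    IsWeightedHomogeneous entryWeight (δ.poly K) δ.weight := by
  have := isWeightedHomogeneous_det entryWeight
    ((genericMatrix K n b δ.arrow).submatrix (δ.rows.orderEmbOfFin rfl)
      (δ.cols.orderEmbOfFin δ.card_cols)) (fun r => ((1 : ℤ), (δ.rows.orderEmbOfFin rfl r : ℤ)))
      (fun c => ((0 : ℤ), (δ.cols.orderEmbOfFin δ.card_cols c : ℤ)))
      (fun r c => by
        simpa [genericMatrix, entryMatrix, entryWeight] using
          isWeightedHomogeneous_X K entryWeight (⟨δ.arrow, δ.rows.orderEmbOfFin rfl r,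
            δ.cols.orderEmbOfFin δ.card_cols c⟩ : EntryIndex n b))
  convert this using 1
  · rfl
  rw [weight, content, ← sum_orderEmbOfFin δ.rows rfl (fun a => (a : ℕ)),
    ← sum_orderEmbOfFin δ.cols δ.card_cols (fun a => (a : ℕ))]
  ext <;> simp [Prod.fst_sum, Prod.snd_sum, size]

/-- Compatibility of two minors of a complex: minors of one matrix have to be comparable; for a
minor of a matrix and one of the next matrix, the rows of the former have to be dominated by the
complement of the columns of the latter: for each `z`, the complement has at least as many elements
below `z`. -/
def Compatible (δ γ : MinorIndex n b) : Prop :=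
  (δ.arrow = γ.arrow → δ ≤ γ ∨ γ ≤ δ) ∧
    ((γ.arrow : ℕ) = δ.arrow + 1 → ∀ z, rankBelow δ.rows z + rankBelow γ.cols z ≤ z)

/-- A multiset of minors is standard if its elements are pairwise compatible. -/
def Standard (T : Multiset (MinorIndex n b)) : Prop := ∀ δ ∈ T, ∀ γ ∈ T, Compatible δ γ

/-- The product of a multiset of minors. -/
noncomputable def prodPoly (K : Type*) [CommRing K] (T : Multiset (MinorIndex n b)) :
    MvPolynomial (EntryIndex n b) K :=
  (T.map (poly K)).prod

/-- The bidegree of a product of minors. -/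
def totalWeight (T : Multiset (MinorIndex n b)) : ℤ × ℤ := (T.map weight).sum

theorem prodPoly_isWeightedHomogeneous (K : Type*) [CommRing K] (T : Multiset (MinorIndex n b)) :
    IsWeightedHomogeneous entryWeight (prodPoly K T) (totalWeight T) := by
  induction T using Multiset.induction with
  | empty => simpa [prodPoly, totalWeight] using isWeightedHomogeneous_one K entryWeight
  | cons δ T ih =>
    simpa [prodPoly, totalWeight] using (poly_isWeightedHomogeneous K δ).mul ih

/-- A coordinate, as a minor of order one. -/
def ofEntry (v : EntryIndex n b) : MinorIndex n b := ⟨v.1, {v.2.1}, {v.2.2}, by simp, by simp⟩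

theorem poly_ofEntry (K : Type*) [CommRing K] (v : EntryIndex n b) : (ofEntry v).poly K = X v := by
  have : (ofEntry v).poly K = (genericMatrix K n b v.1).minor {v.2.1} {v.2.2} (s := 1) (by simp)
    (by simp) := Matrix.minor_congr _ _ _ _ _
  rw [this, Matrix.minor, Matrix.det_unique]
  simp [genericMatrix, entryMatrix]

theorem weight_ofEntry (v : EntryIndex n b) : (ofEntry v).weight = entryWeight v := by
  simp [weight, ofEntry, entryWeight, size, content]

/-- A monomial, as a product of minors of order one. -/
noncomputable def ofMonomial (m : EntryIndex n b →₀ ℕ) : Multiset (MinorIndex n b) :=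
  (Finsupp.toMultiset m).map ofEntry

theorem prodPoly_ofMonomial (K : Type*) [CommRing K] (m : EntryIndex n b →₀ ℕ) :
    prodPoly K (ofMonomial m) = monomial m 1 := by
  induction m using Finsupp.induction_linear with
  | zero => simp [prodPoly, ofMonomial]
  | add f g hf hg =>
    have : prodPoly K (ofMonomial (f + g)) =
        prodPoly K (ofMonomial f) * prodPoly K (ofMonomial g) := by
      simp [prodPoly, ofMonomial]
    rw [this, hf, hg, monomial_mul, one_mul]
  | single v k =>
    simp [prodPoly, ofMonomial, Multiset.map_nsmul, Multiset.prod_nsmul, poly_ofEntry,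
      X_pow_eq_monomial]

theorem totalWeight_ofMonomial (m : EntryIndex n b →₀ ℕ) :
    totalWeight (ofMonomial m) = Finsupp.weight entryWeight m := by
  induction m using Finsupp.induction_linear with
  | zero => simp [totalWeight, ofMonomial]
  | add f g hf hg =>
    have : totalWeight (ofMonomial (f + g)) =
        totalWeight (ofMonomial f) + totalWeight (ofMonomial g) := by
      simp [totalWeight, ofMonomial]
    rw [this, hf, hg, map_add]
  | single v k =>
    simp [totalWeight, ofMonomial, Multiset.map_nsmul, Multiset.sum_nsmul, weight_ofEntry,
      Finsupp.weight_single]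

theorem prodPoly_add (K : Type*) [CommRing K] (T T' : Multiset (MinorIndex n b)) :
    prodPoly K (T + T') = prodPoly K T * prodPoly K T' := by
  simp [prodPoly]

theorem prodPoly_cons (K : Type*) [CommRing K] (δ : MinorIndex n b)
    (T : Multiset (MinorIndex n b)) :
    prodPoly K (δ ::ₘ T) = δ.poly K * prodPoly K T := by
  simp [prodPoly]

end MinorIndex

namespace MinorIndex

variable {n : ℕ} {b : ℕ → ℕ}

theorem totalWeight_eq (T : Multiset (MinorIndex n b)) :
    totalWeight T = (((T.map size).sum : ℤ), ((T.map content).sum : ℤ)) := by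
  induction T using Multiset.induction with
  | empty => rfl
  | cons δ T ih =>
    have : totalWeight (δ ::ₘ T) = weight δ + totalWeight T := by simp [totalWeight]
    rw [this, ih]
    simp [weight]

theorem sum_map_le_mul_size (f : MinorIndex n b → ℕ) (C : ℕ) (hC : ∀ δ, f δ ≤ C)
    (T : Multiset (MinorIndex n b)) : (T.map f).sum ≤ (T.map size).sum * C := by
  induction T using Multiset.induction with
  | empty => simp
  | cons δ T ih =>
    have h1 : 1 * C ≤ δ.size * C := Nat.mul_le_mul_right _ δ.rows_pos
    have := hC δ
    simp only [Multiset.map_cons, Multiset.sum_cons, add_mul]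
    omega

/-- Straightening of a product of minors of two consecutive matrices. -/
theorem poly_mul_poly_mem_of_adjacent {K : Type*} [CommRing K] {δ γ : MinorIndex n b}
    (ha : (γ.arrow : ℕ) = δ.arrow + 1) (z : ℕ)
    (hz : z < rankBelow δ.rows z + rankBelow γ.cols z) :
    γ.poly K * δ.poly K ∈ (complexIdeal K n b).restrictScalars K ⊔
      ⨆ (c : ℤ) (_ : (γ.content : ℤ) + δ.content < c),
        weightedHomogeneousSubmodule K entryWeight ((γ.size + δ.size : ℤ), c) := by
  obtain ⟨⟨k, hk⟩, I, J, hJ, hI⟩ := δ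
  obtain ⟨⟨k', hk'⟩, I', J', hJ', hI'⟩ := γ
  obtain rfl : k' = k + 1 := ha
  have := mixed_mul_minor_mem (K := K) entryWeight (genericMatrix K n b ⟨k + 1, hk'⟩)
    (genericMatrix K n b ⟨k, hk⟩)
    (fun a v => by
      simpa [genericMatrix, entryMatrix, entryWeight] using
          isWeightedHomogeneous_X K entryWeight (⟨⟨k + 1, hk'⟩, a, v⟩ : EntryIndex n b))
    (fun a v => by
      simpa [genericMatrix, entryMatrix, entryWeight] using
          isWeightedHomogeneous_X K entryWeight (⟨⟨k, hk⟩, a, v⟩ : EntryIndex n b))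
    (complexIdeal K n b) (fun a c => Ideal.subset_span ⟨k, hk', a, c, rfl⟩)
    (R := I') (J' := J') (I := I) (J := J) rfl hJ' rfl hJ z hz
  simpa [content, size, poly, eval, genericMatrix] using this

/-- The span of the standard products of minors, together with the ideal of the complexes. -/
noncomputable def standardSpan (K : Type*) [CommRing K] (n : ℕ) (b : ℕ → ℕ) :
    Submodule K (MvPolynomial (EntryIndex n b) K) :=
  (complexIdeal K n b).restrictScalars K ⊔
    Submodule.span K (prodPoly K '' {T : Multiset (MinorIndex n b) | Standard T})

/-- Membership of a homogeneous polynomial in a submodule can be tested on products of minors. -/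
theorem mem_of_isWeightedHomogeneous {K : Type*} [CommRing K]
    (N : Submodule K (MvPolynomial (EntryIndex n b) K)) (e : ℤ × ℤ)
    (h : ∀ T : Multiset (MinorIndex n b), totalWeight T = e → prodPoly K T ∈ N)
    {f : MvPolynomial (EntryIndex n b) K} (hf : IsWeightedHomogeneous entryWeight f e) : f ∈ N := by
  rw [f.as_sum]
  refine sum_mem fun m hm => ?_
  rw [← mul_one (coeff m f), ← smul_eq_mul, ← smul_monomial, ← prodPoly_ofMonomial]
  refine Submodule.smul_mem _ _ (h _ ?_)
  rw [totalWeight_ofMonomial]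
  exact hf (mem_support_iff.1 hm)

/-- The step of the straightening algorithm: a nonstandard product of minors reduces to products
of the same degree with larger content, or with the same content and a larger mass, the sum of the
powers `3 ^ height`. -/
theorem prodPoly_mem_of_not_standard {K : Type*} [CommRing K]
    (N : Submodule K (MvPolynomial (EntryIndex n b) K))
    (hN : (complexIdeal K n b).restrictScalars K ≤ N)
    (T : Multiset (MinorIndex n b)) (hT : ¬ Standard T)
    (h1 : ∀ T' : Multiset (MinorIndex n b), (T'.map size).sum = (T.map size).sum →
      (T.map content).sum < (T'.map content).sum → prodPoly K T' ∈ N)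
    (h2 : ∀ T' : Multiset (MinorIndex n b), (T'.map size).sum = (T.map size).sum →
      (T.map content).sum = (T'.map content).sum →
      (T.map fun δ => 3 ^ δ.height).sum < (T'.map fun δ => 3 ^ δ.height).sum → prodPoly K T' ∈ N) :
    prodPoly K T ∈ N := by
  classical
  simp only [Standard, not_forall] at hT
  obtain ⟨δ, hδ, γ, hγ, hcomp⟩ := hT
  rw [Compatible, not_and_or] at hcomp
  rcases hcomp with hcomp | hcomp
  · -- Two incomparable minors of one matrix; the one of larger height comes first.
    obtain ⟨δ, hδ, γ, hγ, ha, hle, hheight⟩ : ∃ δ ∈ T, ∃ γ ∈ T, δ.arrow = γ.arrow ∧ ¬ δ ≤ γ ∧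
        γ.height ≤ δ.height := by
      push Not at hcomp
      rcases le_total γ.height δ.height with hh | hh
      · exact ⟨δ, hδ, γ, hγ, hcomp.1, hcomp.2.1, hh⟩
      · exact ⟨γ, hγ, δ, hδ, hcomp.1.symm, hcomp.2.2, hh⟩
    have hne : γ ≠ δ := fun h => hle (h ▸ le_refl _)
    obtain ⟨R, rfl⟩ := Multiset.exists_cons_of_mem hδ
    obtain ⟨R, rfl⟩ := Multiset.exists_cons_of_mem
      ((Multiset.mem_cons.1 hγ).resolve_left hne)
    have hmem := mem_span_monomial_mul_of_mem_ideal_span entryWeight _ _ weight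
      (poly_isWeightedHomogeneous K)
      ((poly_isWeightedHomogeneous K δ).mul (poly_isWeightedHomogeneous K γ))
      (poly_mul_poly_mem ha hle)
    rw [prodPoly_cons, prodPoly_cons, ← mul_assoc]
    have hle' : Submodule.span K {q | ∃ (m : EntryIndex n b →₀ ℕ) (ε : MinorIndex n b),
        ε ∈ {ε : MinorIndex n b | δ.height < ε.height} ∧
          Finsupp.weight entryWeight m + weight ε = weight δ + weight γ ∧
          q = monomial m 1 * poly K ε} ≤ N.comap (LinearMap.mulRight K (prodPoly K R)) := by
      rw [Submodule.span_le]
      rintro _ ⟨m, ε, hε, hw, rfl⟩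
      have hprod : monomial m 1 * poly K ε * prodPoly K R =
          prodPoly K (ofMonomial m + ε ::ₘ R) := by
        rw [prodPoly_add, prodPoly_cons, prodPoly_ofMonomial, mul_assoc]
      change monomial m 1 * poly K ε * prodPoly K R ∈ N
      rw [hprod]
      have hwt : totalWeight (ofMonomial m + ε ::ₘ R) = totalWeight (δ ::ₘ γ ::ₘ R) := by
        have e1 : totalWeight (ofMonomial m + ε ::ₘ R) =
            totalWeight (ofMonomial m) + (weight ε + totalWeight R) := by
          simp only [totalWeight, Multiset.map_add, Multiset.sum_add, Multiset.map_cons,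
            Multiset.sum_cons]
        have e2 : totalWeight (δ ::ₘ γ ::ₘ R) = weight δ + (weight γ + totalWeight R) := by
          simp [totalWeight]
        rw [e1, e2, totalWeight_ofMonomial, ← add_assoc, hw, add_assoc]
      rw [totalWeight_eq, totalWeight_eq, Prod.mk.injEq] at hwt
      refine h2 _ (by exact_mod_cast hwt.1) (by exact_mod_cast hwt.2.symm) ?_
      -- One factor of height more than `δ.height` has more mass than both `δ` and `γ`.
      have hε' : 3 ^ (δ.height + 1) ≤ 3 ^ ε.height := Nat.pow_le_pow_right (by norm_num) hε
      have hγ' : 3 ^ γ.height ≤ 3 ^ δ.height := Nat.pow_le_pow_right (by norm_num) hheight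
      have hpos : 0 < 3 ^ δ.height := by positivity
      rw [pow_succ] at hε'
      simp only [Multiset.map_cons, Multiset.sum_cons, Multiset.map_add, Multiset.sum_add]
      omega
    exact hle' hmem
  · push Not at hcomp
    obtain ⟨ha, z, hz⟩ := hcomp
    have hne : δ ≠ γ := by
      rintro rfl
      omega
    obtain ⟨R, rfl⟩ := Multiset.exists_cons_of_mem hγ
    obtain ⟨R, rfl⟩ := Multiset.exists_cons_of_mem
      ((Multiset.mem_cons.1 hδ).resolve_left hne)
    rw [prodPoly_cons, prodPoly_cons, ← mul_assoc]
    refine (?_ : _ ≤ N.comap (LinearMap.mulRight K (prodPoly K R)))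
      (poly_mul_poly_mem_of_adjacent ha z hz)
    refine sup_le (fun f hf => hN (Ideal.mul_mem_right _ _ hf)) (iSup₂_le fun c hc f hf => ?_)
    refine mem_of_isWeightedHomogeneous N _ (fun T' hT' => ?_)
      (IsWeightedHomogeneous.mul hf (prodPoly_isWeightedHomogeneous K R))
    rw [totalWeight_eq, totalWeight_eq, Prod.mk_add_mk, Prod.mk.injEq] at hT'
    refine h1 T' ?_ ?_
    · simp only [Multiset.map_cons, Multiset.sum_cons]
      omega
    · simp only [Multiset.map_cons, Multiset.sum_cons]
      omega

/-- The straightening algorithm terminates, since for a given degree both the content and the mass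
of a product are bounded. -/
theorem prodPoly_mem_standardSpan (K : Type*) [CommRing K] (T : Multiset (MinorIndex n b)) :
    prodPoly K T ∈ standardSpan K n b := by
  obtain ⟨C, hC⟩ := (Set.finite_range (content (n := n) (b := b))).bddAbove
  obtain ⟨W, hW⟩ := (Set.finite_range fun δ : MinorIndex n b => 3 ^ δ.height).bddAbove
  replace hC := fun δ : MinorIndex n b => hC ⟨δ, rfl⟩
  replace hW := fun δ : MinorIndex n b => hW ⟨δ, rfl⟩
  obtain ⟨d, hd⟩ : ∃ d, (T.map size).sum = d := ⟨_, rfl⟩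
  induction hμ : (d * C - (T.map content).sum) * (d * W + 1) +
      (d * W - (T.map fun δ => 3 ^ δ.height).sum) using Nat.strong_induction_on generalizing T with
  | _ μ ih =>
    by_cases hT : Standard T
    · exact Submodule.mem_sup_right (Submodule.subset_span ⟨T, hT, rfl⟩)
    refine prodPoly_mem_of_not_standard _ le_sup_left T hT (fun T' hs hc => ?_)
      (fun T' hs hc hm => ?_)
    · refine ih _ ?_ T' (hs.trans hd) rfl
      have h1 := sum_map_le_mul_size _ C hC T'
      rw [hs, hd] at h1
      have h2 : (d * C - (T'.map content).sum + 1) * (d * W + 1) ≤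
        (d * C - (T.map content).sum) * (d * W + 1) := Nat.mul_le_mul_right _ (by omega)
      rw [add_mul, one_mul] at h2
      omega
    · refine ih _ ?_ T' (hs.trans hd) rfl
      have h1 := sum_map_le_mul_size _ W hW T'
      rw [hs, hd] at h1
      rw [← hc]
      omega

/-- Modulo the ideal of the complexes, every polynomial is a linear combination of standard
products of minors. -/
theorem standardSpan_eq_top (K : Type*) [CommRing K] (n : ℕ) (b : ℕ → ℕ) :
    standardSpan K n b = ⊤ := by
  rw [eq_top_iff]
  intro f _
  rw [f.as_sum]
  refine sum_mem fun m _ => ?_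
  rw [← mul_one (coeff m f), ← smul_eq_mul, ← smul_monomial, ← prodPoly_ofMonomial]
  exact Submodule.smul_mem _ _ (prodPoly_mem_standardSpan K _)

end MinorIndex

/-! ### Leading terms of minors of unitriangular matrices -/

/-- `p` has the term with exponent `e` and coefficient `c`, and no term beyond it. The coefficient
is allowed to vanish. -/
def MonomialOrder.HasLeadingTerm {σ R : Type*} [CommSemiring R] (m : MonomialOrder σ)
    (p : MvPolynomial σ R) (e : σ →₀ ℕ) (c : R) : Prop :=
  m.toSyn (m.degree p) ≤ m.toSyn e ∧ p.coeff e = c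

namespace MonomialOrder.HasLeadingTerm

variable {σ R : Type*} [CommSemiring R] {m : MonomialOrder σ}

theorem one : m.HasLeadingTerm (1 : MvPolynomial σ R) 0 1 := by
  simp [HasLeadingTerm]

theorem mul {p q : MvPolynomial σ R} {e e' : σ →₀ ℕ} {c c' : R} (hp : m.HasLeadingTerm p e c)
    (hq : m.HasLeadingTerm q e' c') : m.HasLeadingTerm (p * q) (e + e') (c * c') := by
  refine ⟨m.degree_mul_le.trans ?_, ?_⟩
  · rw [map_add, map_add]
    exact add_le_add hp.1 hq.1
  · rw [m.coeff_mul_of_add_of_degree_le hp.1 hq.1, hp.2, hq.2]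

theorem multiset_prod {ι : Type*} (T : Multiset ι) (p : ι → MvPolynomial σ R) (e : ι → σ →₀ ℕ)
    (c : ι → R) (h : ∀ i ∈ T, m.HasLeadingTerm (p i) (e i) (c i)) :
    m.HasLeadingTerm (T.map p).prod (T.map e).sum (T.map c).prod := by
  induction T using Multiset.induction with
  | empty => simpa using one
  | cons i T ih =>
    simp only [Multiset.map_cons, Multiset.prod_cons, Multiset.sum_cons]
    exact (h i (Multiset.mem_cons_self _ _)).mul
      (ih fun j hj => h j (Multiset.mem_cons_of_mem hj))

theorem coeff_eq_zero_of_lt {p : MvPolynomial σ R} {e d : σ →₀ ℕ} {c : R}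
    (hp : m.HasLeadingTerm p e c) (h : m.toSyn e < m.toSyn d) : p.coeff d = 0 :=
  m.coeff_eq_zero_of_lt (lt_of_le_of_lt hp.1 h)

/-- A sum of terms with exponents at most `e` has a leading term of exponent `e`. -/
theorem sum_monomial {ι : Type*} (s : Finset ι) (d : ι → σ →₀ ℕ) (a : ι → R)
    (e : σ →₀ ℕ) (h : ∀ i ∈ s, a i ≠ 0 → m.toSyn (d i) ≤ m.toSyn e) :
    m.HasLeadingTerm (∑ i ∈ s, monomial (d i) (a i)) e
      (∑ i ∈ s, (monomial (d i) (a i)).coeff e) := by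
  refine ⟨m.degree_le_iff.2 fun x hx => ?_, by rw [coeff_sum]⟩
  rw [mem_support_iff, coeff_sum] at hx
  obtain ⟨i, hi, hne⟩ := Finset.exists_ne_zero_of_sum_ne_zero hx
  classical
  rw [coeff_monomial] at hne
  split_ifs at hne with hd
  · subst hd
    exact h i hi hne
  · exact absurd rfl hne

end MonomialOrder.HasLeadingTerm

/-- The variables of the flag matrices, ordered so that for each flag the variables of later
columns, and in one column those of later rows, are larger for the lexicographic order on
monomials. -/
abbrev FlagVar : Type := (ℕ ×ₗ ℕ ×ₗ ℕ)ᵒᵈ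

/-- The variable in row `a` and column `k` of the flag matrix at the vertex `v`. -/
def flagVar (v k a : ℕ) : FlagVar := OrderDual.toDual (toLex (v, toLex (k, a)))

theorem flagVar_lt {v k a v' k' a' : ℕ} : flagVar v k a < flagVar v' k' a' ↔
    v' < v ∨ v' = v ∧ (k' < k ∨ k' = k ∧ a' < a) := by
  simp [flagVar, Prod.Lex.toLex_lt_toLex]

theorem flagVar_inj {v k a v' k' a' : ℕ} : flagVar v k a = flagVar v' k' a' ↔
    v = v' ∧ k = k' ∧ a = a' := by
  simp [flagVar]

theorem flagVar_surj (x : FlagVar) : ∃ v k a, x = flagVar v k a :=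
  ⟨(ofLex (OrderDual.ofDual x)).1, (ofLex (ofLex (OrderDual.ofDual x)).2).1,
    (ofLex (ofLex (OrderDual.ofDual x)).2).2, rfl⟩

/-- The generic lower unitriangular matrix at the vertex `v`. Its leading columns span a generic
flag. -/
noncomputable def flagMatrix (R : Type*) [CommRing R] (v m : ℕ) :
    Matrix (Fin m) (Fin m) (MvPolynomial FlagVar R) :=
  Matrix.of fun a k => if a < k then 0 else if a = k then 1 else X (flagVar v k a)

/-- The exponent of the leading monomial of the minor of a flag matrix formed by the rows `I` and
the first columns: the product of its diagonal entries. -/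
noncomputable def flagExp (v : ℕ) {m : ℕ} (I : Finset (Fin m)) : FlagVar →₀ ℕ :=
  ∑ a ∈ I, if rankBelow I a < a then Finsupp.single (flagVar v (rankBelow I a) a) 1 else 0

theorem rankBelow_orderEmbOfFin {m s : ℕ} (I : Finset (Fin m)) (hI : I.card = s) (k : Fin s) :
    rankBelow I (I.orderEmbOfFin hI k) = k := by
  rw [← card_filter_orderEmbOfFin_lt I hI]
  simp only [Fin.val_fin_lt, OrderEmbedding.lt_iff_lt]
  rw [Finset.filter_gt_eq_Iio, Fin.card_Iio]

/-- The value at one variable of the exponent of a product of variables, one from each of the first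
`s` columns. -/
theorem sum_flagVar_apply {s m : ℕ} (v : ℕ) (f : Fin s → Fin m) (k a : ℕ) :
    (∑ l : Fin s, if (l : ℕ) < f l then Finsupp.single (flagVar v l (f l)) 1 else 0 : FlagVar →₀ ℕ)
      (flagVar v k a) = if ∃ h : k < s, k < f ⟨k, h⟩ ∧ (f ⟨k, h⟩ : ℕ) = a then 1 else 0 := by
  rw [Finsupp.finsetSum_apply]
  split_ifs with h
  · obtain ⟨h, h1, h2⟩ := h
    rw [Finset.sum_eq_single ⟨k, h⟩]
    · subst h2
      simp [h1]
    · intro l _ hl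
      split_ifs
      · rw [Finsupp.single_apply, if_neg]
        rw [flagVar_inj]
        rintro ⟨-, h, -⟩
        exact hl (Fin.ext h)
      · rfl
    · simp
  · refine Finset.sum_eq_zero fun l _ => ?_
    split_ifs with hl
    · rw [Finsupp.single_apply, if_neg]
      rw [flagVar_inj]
      rintro ⟨-, rfl, h'⟩
      exact h ⟨l.2, hl, h'⟩
    · rfl

theorem sum_flagVar_apply_of_ne {s m v v' : ℕ} (hv : v ≠ v') (f : Fin s → Fin m) (k a : ℕ) :
    (∑ l : Fin s, if (l : ℕ) < f l then Finsupp.single (flagVar v l (f l)) 1 else 0 : FlagVar →₀ ℕ)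
      (flagVar v' k a) = 0 := by
  rw [Finsupp.finsetSum_apply]
  refine Finset.sum_eq_zero fun l _ => ?_
  split_ifs with hl
  · rw [Finsupp.single_apply, if_neg]
    rw [flagVar_inj]
    exact fun h => hv h.1
  · rfl

theorem flagExp_eq_sum {m s : ℕ} (v : ℕ) (I : Finset (Fin m)) (hI : I.card = s) :
    flagExp v I = ∑ l : Fin s, if (l : ℕ) < I.orderEmbOfFin hI l then
      Finsupp.single (flagVar v l (I.orderEmbOfFin hI l)) 1 else 0 := by
  rw [flagExp, ← sum_orderEmbOfFin I hI]
  simp only [rankBelow_orderEmbOfFin]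

theorem le_orderEmb {m s : ℕ} (i : Fin s ↪o Fin m) (k : Fin s) : (k : ℕ) ≤ i k := by
  obtain ⟨k, hk⟩ := k
  induction k with
  | zero => simp
  | succ k ih =>
    have h1 := ih (by omega)
    have h2 : i ⟨k, by omega⟩ < i ⟨k + 1, hk⟩ := i.strictMono (by simp)
    simp only [Fin.lt_def] at h1 h2 ⊢
    omega

/-- The leading term of a minor of a flag matrix formed by its first columns is the product of the
diagonal entries. -/
theorem flagMatrix_det_hasLeadingTerm (R : Type*) [CommRing R] (v : ℕ) {m s : ℕ}
    (I : Finset (Fin m)) (hI : I.card = s) (hs : s ≤ m) :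
    (MonomialOrder.lex (σ := FlagVar)).HasLeadingTerm
      ((flagMatrix R v m).submatrix (I.orderEmbOfFin hI) (Fin.castLE hs)).det (flagExp v I) 1 := by
  classical
  set i := I.orderEmbOfFin hI with hi
  let E : Equiv.Perm (Fin s) → FlagVar →₀ ℕ := fun τ =>
    ∑ l : Fin s, if (l : ℕ) < i (τ l) then Finsupp.single (flagVar v l (i (τ l))) 1 else 0
  let a : Equiv.Perm (Fin s) → R := fun τ =>
    if ∀ l : Fin s, (l : ℕ) ≤ i (τ l) then ((Equiv.Perm.sign τ : ℤ) : R) else 0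
  have hdet : ((flagMatrix R v m).submatrix i (Fin.castLE hs)).det = ∑ τ, monomial (E τ) (a τ) := by
    rw [Matrix.det_apply']
    refine Finset.sum_congr rfl fun τ _ => ?_
    by_cases hτ : ∀ l : Fin s, (l : ℕ) ≤ i (τ l)
    · simp only [a, if_pos hτ, E]
      have : ∀ l, (flagMatrix R v m).submatrix i (Fin.castLE hs) (τ l) l =
          monomial
            (if (l : ℕ) < i (τ l) then Finsupp.single (flagVar v l (i (τ l))) 1 else 0) 1 := by
        intro l
        simp only [Matrix.submatrix_apply, flagMatrix, Matrix.of_apply]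
        rw [if_neg (by rw [Fin.lt_def]; exact not_lt.2 (hτ l))]
        rcases (hτ l).eq_or_lt with h | h
        · rw [if_pos (Fin.ext h.symm), if_neg (by omega)]
          rfl
        · rw [if_neg (fun h' => by rw [h'] at h; simp at h), if_pos h]
          rfl
      rw [Finset.prod_congr rfl fun l _ => this l, ← monomial_sum_one,
        ← map_intCast (C : R →+* MvPolynomial FlagVar R), C_mul_monomial, mul_one]
    · simp only [a, if_neg hτ, map_zero]
      push Not at hτ
      obtain ⟨l, hl⟩ := hτ
      rw [Finset.prod_eq_zero (Finset.mem_univ l), mul_zero]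
      simp only [Matrix.submatrix_apply, flagMatrix, Matrix.of_apply]
      rw [if_pos]
      exact hl
  have hE1 : E 1 = flagExp v I := (flagExp_eq_sum v I hI).symm
  have ha1 : a 1 = 1 := by simp [a, le_orderEmb]
  have hlt : ∀ τ, τ ≠ 1 → a τ ≠ 0 →
      MonomialOrder.lex.toSyn (E τ) < MonomialOrder.lex.toSyn (E 1) := by
    intro τ hτ ha
    have hle : ∀ l : Fin s, (l : ℕ) ≤ i (τ l) := by
      by_contra h
      exact ha (if_neg h)
    -- The largest column in which the two terms differ.
    obtain ⟨k, hk, hmax⟩ := (Finset.univ.filter fun l => τ l ≠ l).exists_max_image id (by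
      by_contra h
      rw [Finset.not_nonempty_iff_eq_empty, Finset.filter_eq_empty_iff] at h
      exact hτ (Equiv.ext fun l => by simpa using h (Finset.mem_univ l)))
    rw [Finset.mem_filter] at hk
    have hfix : ∀ l, k < l → τ l = l := fun l hl => by
      by_contra h
      exact absurd (hmax l (Finset.mem_filter.2 ⟨Finset.mem_univ _, h⟩)) (not_le.2 hl)
    have hτk : τ k < k := by
      refine lt_of_le_of_ne (not_lt.1 fun h => ?_) hk.2
      exact hk.2 (τ.injective (hfix _ h))
    have hik : (i (τ k) : ℕ) < i k := i.strictMono hτk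
    rw [MonomialOrder.lex_lt_iff, Finsupp.Lex.lt_iff]
    refine ⟨flagVar v k (i k), fun x hx => ?_, ?_⟩
    · obtain ⟨v', k', a', rfl⟩ := flagVar_surj x
      rw [flagVar_lt] at hx
      by_cases hv : v = v'
      · subst hv
        simp only [ofLex_toLex, E]
        rw [sum_flagVar_apply v (fun l => i (τ l)),
          sum_flagVar_apply v (fun l => i ((1 : Equiv.Perm (Fin s)) l))]
        have hx' : (k : ℕ) < k' ∨ (k : ℕ) = k' ∧ (i k : ℕ) < a' := by omega
        rcases hx' with h | ⟨h, h'⟩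
        · have : ∀ hks : k' < s, τ ⟨k', hks⟩ = ⟨k', hks⟩ := fun hks => hfix _ h
          simp only [this, Equiv.Perm.one_apply]
          rfl
        · subst h
          rw [if_neg, if_neg]
          · rintro ⟨_, _, h2⟩
            simp at h2
            omega
          · rintro ⟨_, _, h2⟩
            simp at h2
            omega
      · simp only [ofLex_toLex, E]
        rw [sum_flagVar_apply_of_ne hv (fun l => i (τ l)),
          sum_flagVar_apply_of_ne hv (fun l => i ((1 : Equiv.Perm (Fin s)) l))]
    · simp only [ofLex_toLex, E]
      rw [sum_flagVar_apply v (fun l => i (τ l)),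
        sum_flagVar_apply v (fun l => i ((1 : Equiv.Perm (Fin s)) l)),
        if_neg, if_pos]
      · exact Nat.one_pos
      · have := hle k
        exact ⟨k.2, by simp; omega, by simp⟩
      · rintro ⟨_, _, h2⟩
        simp at h2
        omega
  rw [hdet, ← hE1]
  have := MonomialOrder.HasLeadingTerm.sum_monomial (m := MonomialOrder.lex) Finset.univ E a (E 1)
    (fun τ _ ha => by
      by_cases hτ : τ = 1
      · rw [hτ]
      · exact (hlt τ hτ ha).le)
  convert this using 1
  rw [Finset.sum_eq_single 1]
  · simp [ha1]
  · intro τ _ hτ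
    rw [coeff_monomial]
    split_ifs with h
    · by_contra ha
      exact absurd (hlt τ hτ ha) (by rw [h]; exact lt_irrefl _)
    · rfl
  · simp

/-- The expansion of the determinant of a product along the rows of the second factor. -/
theorem Matrix.det_mul_eq_sum_prod_mul_det {ι κ A : Type*} [Fintype ι] [DecidableEq ι] [Fintype κ]
    [DecidableEq κ] [CommRing A] (P : Matrix ι κ A) (Q : Matrix κ ι A) :
    (P * Q).det = ∑ f : ι → κ, (∏ i, P i (f i)) * (Q.submatrix f id).det := by
  have h : (P * Q) = fun i => ∑ j, P i j • Q j := by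
    ext i j
    simp [Matrix.mul_apply, Finset.sum_apply]
  change Matrix.detRowAlternating.toMultilinearMap (P * Q) = _
  rw [h, MultilinearMap.map_sum]
  refine Finset.sum_congr rfl fun f _ => ?_
  rw [MultilinearMap.map_smul_univ, smul_eq_mul]
  rfl

/-- Jacobi's identity between complementary minors of inverse matrices. -/
theorem Matrix.det_submatrix_mul_det_submatrix_of_mul_eq_one {ι κ μ A : Type*} [Fintype ι]
    [DecidableEq ι] [Fintype κ] [DecidableEq κ] [Fintype μ] [DecidableEq μ] [CommRing A]
    {G H : Matrix μ μ A} (h : G * H = 1) (e f : ι ⊕ κ ≃ μ) :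
    (G.submatrix e f).det * (H.submatrix (f ∘ Sum.inl) (e ∘ Sum.inl)).det =
      (G.submatrix (e ∘ Sum.inr) (f ∘ Sum.inr)).det := by
  have h1 : G.submatrix e f * H.submatrix f e = 1 := by
    rw [Matrix.submatrix_mul_equiv, h, Matrix.submatrix_one_equiv]
  rw [← Matrix.fromBlocks_toBlocks (G.submatrix e f), ← Matrix.fromBlocks_toBlocks
    (H.submatrix f e), Matrix.fromBlocks_multiply, ← Matrix.fromBlocks_one,
    Matrix.fromBlocks_inj] at h1
  obtain ⟨h11, -, h21, -⟩ := h1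
  have h2 : G.submatrix e f * Matrix.fromBlocks (H.submatrix f e).toBlocks₁₁ 0
      (H.submatrix f e).toBlocks₂₁ 1 = Matrix.fromBlocks 1 (G.submatrix e f).toBlocks₁₂ 0
        (G.submatrix e f).toBlocks₂₂ := by
    conv_lhs => rw [← Matrix.fromBlocks_toBlocks (G.submatrix e f)]
    rw [Matrix.fromBlocks_multiply, h11, h21]
    simp
  have h3 := congrArg Matrix.det h2
  rw [Matrix.det_mul, Matrix.det_fromBlocks_zero₁₂, Matrix.det_fromBlocks_zero₂₁, Matrix.det_one,
    Matrix.det_one, mul_one, one_mul] at h3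
  exact h3

theorem Matrix.exists_intUnits_det_submatrix_equiv {ι μ A : Type*} [Fintype ι] [DecidableEq ι]
    [Fintype μ] [DecidableEq μ] [CommRing A] (G : Matrix μ μ A) (e f : ι ≃ μ) :
    ∃ u : ℤˣ, (G.submatrix e f).det = ((u : ℤ) : A) * G.det := by
  refine ⟨Equiv.Perm.sign (e.symm.trans f), ?_⟩
  rw [← Matrix.det_permute', ← Matrix.det_submatrix_equiv_self e (G.submatrix id _),
    Matrix.submatrix_submatrix]
  congr 1
  ext i j
  simp

/-- The coordinates `Fin m`, enumerated with the last `s` of them first, in decreasing order,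
followed by the first `t` of them in increasing order. -/
noncomputable def lastFirstEquiv {s t m : ℕ} (h : s + t = m) : Fin s ⊕ Fin t ≃ Fin m :=
  Equiv.ofBijective (Sum.elim (fun r => Fin.rev (Fin.castLE (h ▸ Nat.le_add_right s t) r))
    (Fin.castLE (h ▸ Nat.le_add_left t s))) (by
      rw [Fintype.bijective_iff_injective_and_card]
      refine ⟨?_, by simp [h]⟩
      rintro (i | i) (j | j) hij
      · simpa using hij
      · have := congrArg Fin.val hij
        simp [Fin.rev] at this
        omega
      · have := congrArg Fin.val hij
        simp [Fin.rev] at this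
        omega
      · simpa using hij)

theorem flagMatrix_det (R : Type*) [CommRing R] (v m : ℕ) : (flagMatrix R v m).det = 1 := by
  rw [Matrix.det_of_isLowerTriangular]
  · simp [flagMatrix]
  · intro i j hij
    have : i < j := hij
    simp [flagMatrix, this]

/-- The inverse of a flag matrix. -/
noncomputable def coflagMatrix (R : Type*) [CommRing R] (v m : ℕ) :
    Matrix (Fin m) (Fin m) (MvPolynomial FlagVar R) := (flagMatrix R v m).adjugate

theorem flagMatrix_mul_coflagMatrix (R : Type*) [CommRing R] (v m : ℕ) :
    flagMatrix R v m * coflagMatrix R v m = 1 := by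
  rw [coflagMatrix, Matrix.mul_adjugate, flagMatrix_det, one_smul]

theorem coflagMatrix_mul_flagMatrix (R : Type*) [CommRing R] (v m : ℕ) :
    coflagMatrix R v m * flagMatrix R v m = 1 := by
  rw [coflagMatrix, Matrix.adjugate_mul, flagMatrix_det, one_smul]

/-- A minor of the inverse of a flag matrix formed by its last rows is, up to sign, the
complementary minor of the flag matrix. -/
theorem coflagMatrix_det_hasLeadingTerm (R : Type*) [CommRing R] (v : ℕ) {m s : ℕ}
    (J : Finset (Fin m)) (hJ : J.card = s) (hs : s ≤ m) : ∃ c : R, IsUnit c ∧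
    (MonomialOrder.lex (σ := FlagVar)).HasLeadingTerm
      ((coflagMatrix R v m).submatrix (fun r => Fin.rev (Fin.castLE hs r))
        (J.orderEmbOfFin hJ)).det (flagExp v Jᶜ) c := by
  have hJc : Jᶜ.card = m - s := by rw [Finset.card_compl, hJ, Fintype.card_fin]
  let e : Fin s ⊕ Fin (m - s) ≃ Fin m := finSumEquivOfFinset hJ hJc
  let f : Fin s ⊕ Fin (m - s) ≃ Fin m := lastFirstEquiv (by omega)
  have h1 := Matrix.det_submatrix_mul_det_submatrix_of_mul_eq_one
    (flagMatrix_mul_coflagMatrix R v m) e f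
  obtain ⟨u, hu⟩ := (flagMatrix R v m).exists_intUnits_det_submatrix_equiv e f
  have h2 : (e ∘ Sum.inr : Fin (m - s) → Fin m) = Jᶜ.orderEmbOfFin hJc := by
    ext i
    simp [e]
  have h3 : (e ∘ Sum.inl : Fin s → Fin m) = J.orderEmbOfFin hJ := by
    ext i
    simp [e]
  rw [h2, h3, hu, flagMatrix_det, mul_one] at h1
  have h4 : ((coflagMatrix R v m).submatrix (f ∘ Sum.inl) (J.orderEmbOfFin hJ)).det =
      C ((u : ℤ) : R) *
        ((flagMatrix R v m).submatrix (Jᶜ.orderEmbOfFin hJc) (f ∘ Sum.inr)).det := by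
    rw [← h1, ← mul_assoc, map_intCast, ← Int.cast_mul, ← Units.val_mul, Int.units_mul_self]
    simp
  have h5 : (f ∘ Sum.inl : Fin s → Fin m) = fun r => Fin.rev (Fin.castLE hs r) := rfl
  have h6 : (f ∘ Sum.inr : Fin (m - s) → Fin m) = Fin.castLE (Nat.sub_le m s) := rfl
  rw [h5, h6] at h4
  refine ⟨((u : ℤ) : R), u.isUnit.map (Int.castRingHom R), ?_⟩
  rw [h4]
  have h7 : (MonomialOrder.lex (σ := FlagVar)).HasLeadingTerm (C ((u : ℤ) : R)) 0 ((u : ℤ) : R) :=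
    ⟨by rw [MonomialOrder.degree_C], by rw [coeff_C, if_pos rfl]⟩
  simpa using h7.mul (flagMatrix_det_hasLeadingTerm R v Jᶜ hJc (Nat.sub_le m s))

/-! ### Leading terms of minors of a generic complex -/

/-- The variables of the diagonal parts of the matrices of a generic complex whose `k`-th matrix has
rank `ρ k`. The ones nearer to the corner are larger for the lexicographic order on monomials. -/
abbrev DiagVar {n : ℕ} (ρ : Fin n → ℕ) : Type := Σₗ k : Fin n, Fin (ρ k)

section Diag

variable {n : ℕ} {ρ : Fin n → ℕ}

/-- The variable at the position `r` of the `k`-th diagonal part. -/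
def diagVar (k : Fin n) (r : Fin (ρ k)) : DiagVar ρ := toLex ⟨k, r⟩

theorem diagVar_injective (k : Fin n) : Function.Injective (diagVar (ρ := ρ) k) := fun r r' h => by
  have := toLex.injective h
  simpa using this

/-- The product of the variables at a set of positions of the `k`-th diagonal part, as an
exponent. -/
noncomputable def diagExp (k : Fin n) (S : Finset (Fin (ρ k))) : DiagVar ρ →₀ ℕ :=
  ∑ r ∈ S, Finsupp.single (diagVar k r) 1

theorem diagExp_apply_self (k : Fin n) (S : Finset (Fin (ρ k))) (r : Fin (ρ k)) :
    diagExp k S (diagVar k r) = if r ∈ S then 1 else 0 := by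
  classical
  rw [diagExp, Finsupp.finsetSum_apply]
  simp [Finsupp.single_apply, (diagVar_injective k).eq_iff]

theorem diagExp_apply_of_ne {k k' : Fin n} (h : k' ≠ k) (S : Finset (Fin (ρ k))) (r : Fin (ρ k')) :
    diagExp k S (diagVar k' r) = 0 := by
  classical
  rw [diagExp, Finsupp.finsetSum_apply]
  refine Finset.sum_eq_zero fun r' _ => ?_
  rw [Finsupp.single_apply, if_neg]
  intro h'
  exact h (congrArg Sigma.fst (toLex.injective h')).symm

/-- The first `s` positions. -/
def firstPositions (ρ s : ℕ) : Finset (Fin ρ) := Finset.univ.filter fun r => (r : ℕ) < s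

theorem mem_firstPositions {ρ s : ℕ} {r : Fin ρ} : r ∈ firstPositions ρ s ↔ (r : ℕ) < s := by
  simp [firstPositions]

theorem card_firstPositions {ρ s : ℕ} (hs : s ≤ ρ) : (firstPositions ρ s).card = s := by
  have : firstPositions ρ s = Finset.univ.map (Fin.castLEEmb hs) := by
    ext r
    simp only [mem_firstPositions, Finset.mem_map, Finset.mem_univ, true_and, Fin.castLEEmb_apply]
    exact ⟨fun h => ⟨⟨r, h⟩, rfl⟩, by rintro ⟨i, rfl⟩; exact i.2⟩
  rw [this]
  simp

/-- Among the monomials given by sets of `s` positions, the one given by the first `s` positions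
is the largest. -/
theorem diagExp_lt (k : Fin n) {s : ℕ} (hs : s ≤ ρ k) (S : Finset (Fin (ρ k))) (hS : S.card = s)
    (hne : S ≠ firstPositions (ρ k) s) :
    MonomialOrder.lex.toSyn (diagExp k S) <
      MonomialOrder.lex.toSyn (diagExp k (firstPositions (ρ k) s)) := by
  classical
  have hex : (firstPositions (ρ k) s \ S).Nonempty := by
    rw [Finset.nonempty_iff_ne_empty]
    intro h
    rw [Finset.sdiff_eq_empty_iff_subset] at h
    exact hne (Finset.eq_of_subset_of_card_le h (by rw [hS, card_firstPositions hs])).symm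
  obtain ⟨j, hj, hmin⟩ := Finset.exists_min_image _ id hex
  rw [Finset.mem_sdiff, mem_firstPositions] at hj
  rw [MonomialOrder.lex_lt_iff, Finsupp.Lex.lt_iff]
  refine ⟨diagVar k j, fun x hx => ?_, ?_⟩
  · obtain ⟨⟨k', r⟩, rfl⟩ := toLex.surjective x
    change (diagExp k S) (diagVar k' r) = diagExp k (firstPositions (ρ k) s) (diagVar k' r)
    by_cases hk : k' = k
    · subst hk
      rw [diagExp_apply_self, diagExp_apply_self]
      have hr : r < j := by
        rw [diagVar, Sigma.Lex.lt_def] at hx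
        rcases hx with h | ⟨_, h⟩
        · exact absurd h (lt_irrefl _)
        · exact h
      have h1 : r ∈ firstPositions (ρ k') s := mem_firstPositions.2 (lt_trans hr hj.1)
      have h2 : r ∈ S := by
        by_contra h
        exact absurd (hmin r (Finset.mem_sdiff.2 ⟨h1, h⟩)) (not_le.2 hr)
      simp [h1, h2]
    · rw [diagExp_apply_of_ne hk, diagExp_apply_of_ne hk]
  · change (diagExp k S) (diagVar k j) < diagExp k (firstPositions (ρ k) s) (diagVar k j)
    rw [diagExp_apply_self, diagExp_apply_self, if_neg hj.2, if_pos (mem_firstPositions.2 hj.1)]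
    exact Nat.one_pos

/-- The leading term of the determinant of a product `P * T * Q` with `T` a diagonal matrix of
variables: the product of the first variables, with the product of the minors formed by the first
columns of `P` and the first rows of `Q`. -/
theorem det_mul_diag_mul_hasLeadingTerm {A : Type*} [CommRing A] {s : ℕ} (k : Fin n) (hs : s ≤ ρ k)
    (P : Matrix (Fin s) (Fin (ρ k)) A) (Q : Matrix (Fin (ρ k)) (Fin s) A) :
    (MonomialOrder.lex (σ := DiagVar ρ)).HasLeadingTerm
      ((Matrix.of fun i r => C (P i r) * X (diagVar k r)) * Q.map (C (σ := DiagVar ρ))).det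
      (diagExp k (firstPositions (ρ k) s))
      ((P.submatrix id (Fin.castLE hs)).det * (Q.submatrix (Fin.castLE hs) id).det) := by
  classical
  -- The expansion of the determinant along the rows of `Q`: coefficients and exponents.
  let W : (Fin s → Fin (ρ k)) → A := fun f => (∏ i, P i (f i)) * (Q.submatrix f id).det
  let E : (Fin s → Fin (ρ k)) → DiagVar ρ →₀ ℕ := fun f => ∑ i, Finsupp.single (diagVar k (f i)) 1
  have hW : ∀ f, W f ≠ 0 → Function.Injective f := fun f hf i j hij => by
    by_contra hne
    refine hf ?_
    simp only [W]
    rw [Matrix.det_zero_of_row_eq hne, mul_zero]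
    ext x
    simp [hij]
  have hE : ∀ f : Fin s → Fin (ρ k), Function.Injective f →
      E f = diagExp k (Finset.univ.image f) := fun f hf => by
    simp only [E, diagExp]
    rw [Finset.sum_image fun i _ j _ h => hf h]
  have hcard : ∀ f : Fin s → Fin (ρ k), Function.Injective f →
      (Finset.univ.image f).card = s := fun f hf => by
    rw [Finset.card_image_of_injective _ hf]
    simp
  have hdet : ((Matrix.of fun i r => C (P i r) * X (diagVar k r)) *
      Q.map (C (σ := DiagVar ρ))).det = ∑ f, monomial (E f) (W f) := by
    rw [Matrix.det_mul_eq_sum_prod_mul_det]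
    refine Finset.sum_congr rfl fun f _ => ?_
    simp only [Matrix.of_apply, W, E]
    rw [Finset.prod_mul_distrib, ← map_prod, monomial_eq]
    have : ((Q.map (C (σ := DiagVar ρ))).submatrix f id).det = C (Q.submatrix f id).det := by
      rw [RingHom.map_det]
      rfl
    rw [this, map_mul]
    have h2 : ((∑ i, Finsupp.single (diagVar k (f i)) 1 : DiagVar ρ →₀ ℕ).prod
        fun n e => (X n : MvPolynomial (DiagVar ρ) A) ^ e) = ∏ i, X (diagVar k (f i)) := by
      rw [← Finsupp.prod_finsetSum_index (fun _ => pow_zero _) fun _ _ _ => pow_add _ _ _]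
      simp
    rw [h2]
    ring
  rw [hdet]
  have := MonomialOrder.HasLeadingTerm.sum_monomial (m := MonomialOrder.lex) Finset.univ E W
    (diagExp k (firstPositions (ρ k) s)) (fun f _ hf => by
      rw [hE f (hW f hf)]
      by_cases h : Finset.univ.image f = firstPositions (ρ k) s
      · rw [h]
      · exact (diagExp_lt k hs _ (hcard f (hW f hf)) h).le)
  convert this using 1
  rw [← Matrix.det_mul, Matrix.det_mul_eq_sum_prod_mul_det]
  have hinj : Function.Injective fun (g : Fin s → Fin s) i => Fin.castLE hs (g i) :=
    fun g g' h => funext fun i => Fin.castLE_injective hs (congrFun h i)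
  rw [← Finset.sum_subset (Finset.subset_univ (Finset.univ.map ⟨_, hinj⟩)), Finset.sum_map]
  · refine Finset.sum_congr rfl fun g _ => ?_
    change W (fun i => Fin.castLE hs (g i)) = _
    simp only [Function.Embedding.coeFn_mk]
    by_cases h0 : W (fun i => Fin.castLE hs (g i)) = 0
    · rw [h0]
      simp
    have hi := hW _ h0
    rw [coeff_monomial, if_pos]
    rw [hE _ hi]
    congr 1
    refine Finset.eq_of_subset_of_card_le (fun j hj => ?_)
      (by rw [hcard _ hi, card_firstPositions hs])
    simp only [Finset.mem_image, Finset.mem_univ, true_and] at hj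
    obtain ⟨i, rfl⟩ := hj
    simp [mem_firstPositions]
  · intro f _ hf
    rw [coeff_monomial]
    split_ifs with h
    · by_contra h0
      have hi := hW _ h0
      refine hf ?_
      have himg : Finset.univ.image f = firstPositions (ρ k) s := by
        by_contra hne
        have := diagExp_lt k hs _ (hcard f hi) hne
        rw [← hE f hi, h] at this
        exact lt_irrefl _ this
      have hlt : ∀ i, (f i : ℕ) < s := fun i => by
        rw [← mem_firstPositions, ← himg]
        exact Finset.mem_image_of_mem _ (Finset.mem_univ i)
      rw [Finset.mem_map]
      exact ⟨fun i => ⟨f i, hlt i⟩, Finset.mem_univ _, rfl⟩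
    · rfl

end Diag

theorem map_mem_varietyOfComplexes {A B : Type*} [CommRing A] [CommRing B] (f : A →+* B) {n : ℕ}
    {b : ℕ → ℕ} {y : EntryIndex n b → A} (hy : y ∈ varietyOfComplexes A n b) :
    (fun v => f (y v)) ∈ varietyOfComplexes B n b := by
  intro k h
  have := congrArg (fun M => M.map f) (hy k h)
  simp only [Matrix.map_mul, Matrix.map_zero _ (map_zero f)] at this
  exact this

section GenericComplex

variable (R : Type*) [CommRing R] {n : ℕ} {b : ℕ → ℕ} {ρ : Fin n → ℕ}
  (h₁ : ∀ k : Fin n, ρ k ≤ b (k + 1)) (h₂ : ∀ k : Fin n, ρ k ≤ b k)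

/-- The left factor of a matrix of the generic complex: the first columns of a flag matrix,
scaled by variables. -/
noncomputable def leftFactor (k : Fin n) :
    Matrix (Fin (b (k + 1))) (Fin (ρ k)) (MvPolynomial (DiagVar ρ) (MvPolynomial FlagVar R)) :=
  Matrix.of fun i r => C (flagMatrix R (k + 1) (b (k + 1)) i (Fin.castLE (h₁ k) r)) *
    X (diagVar k r)

/-- The right factor of a matrix of the generic complex: the last rows of the inverse of a flag
matrix. -/
noncomputable def rightFactor (k : Fin n) :
    Matrix (Fin (ρ k)) (Fin (b k)) (MvPolynomial (DiagVar ρ) (MvPolynomial FlagVar R)) :=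
  ((coflagMatrix R k (b k)).submatrix (fun r => Fin.rev (Fin.castLE (h₂ k) r)) id).map C

/-- A family of complexes whose `k`-th matrix has rank at most `ρ k`: normal forms, moved by
generic unitriangular matrices. -/
noncomputable def genericComplex :
    EntryIndex n b → MvPolynomial (DiagVar ρ) (MvPolynomial FlagVar R) :=
  fun v => (leftFactor R h₁ v.1 * rightFactor R h₂ v.1) v.2.1 v.2.2

theorem entryMatrix_genericComplex (k : Fin n) :
    entryMatrix (genericComplex R h₁ h₂) k = leftFactor R h₁ k * rightFactor R h₂ k := rfl

/-- The product of two consecutive matrices of the generic complex contains a block of the identity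
matrix that does not meet the diagonal. -/
theorem genericComplex_mem
    (h : ∀ (k : ℕ) (hk : k + 1 < n), ρ ⟨k, Nat.lt_of_succ_lt hk⟩ + ρ ⟨k + 1, hk⟩ ≤ b (k + 1)) :
    genericComplex R h₁ h₂ ∈ varietyOfComplexes _ n b := by
  intro k hk
  have h0 : rightFactor R h₂ ⟨k + 1, hk⟩ * leftFactor R h₁ ⟨k, Nat.lt_of_succ_lt hk⟩ = 0 := by
    ext1 r r'
    have h1 := congrFun (congrFun (coflagMatrix_mul_flagMatrix R (k + 1) (b (k + 1)))
      (Fin.rev (Fin.castLE (h₂ ⟨k + 1, hk⟩) r)))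
      (Fin.castLE (h₁ ⟨k, Nat.lt_of_succ_lt hk⟩) r')
    rw [Matrix.one_apply_ne, Matrix.mul_apply] at h1
    · simp only [Matrix.mul_apply, rightFactor, leftFactor, Matrix.map_apply,
        Matrix.submatrix_apply, Matrix.of_apply, ← mul_assoc, ← map_mul, id]
      rw [← Finset.sum_mul, ← map_sum]
      simp only [Matrix.zero_apply]
      convert zero_mul _
      rw [← map_zero (C (σ := DiagVar ρ))]
      exact congrArg _ h1
    · intro heq
      have := congrArg Fin.val heq
      simp only [Fin.val_rev, Fin.val_castLE] at this
      have := r.2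
      have := r'.2
      have := h k hk
      omega
  rw [entryMatrix_genericComplex, entryMatrix_genericComplex, Matrix.mul_assoc,
    ← Matrix.mul_assoc (rightFactor R h₂ ⟨k + 1, hk⟩), h0, Matrix.zero_mul, Matrix.mul_zero]

theorem map_genericComplex_mem_rankVariety {S : Type*} [CommRing S] [IsDomain S]
    (f : MvPolynomial (DiagVar ρ) (MvPolynomial FlagVar R) →+* S)
    (h : ∀ (k : ℕ) (hk : k + 1 < n), ρ ⟨k, Nat.lt_of_succ_lt hk⟩ + ρ ⟨k + 1, hk⟩ ≤ b (k + 1))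
    {r : Fin n → ℕ} (hr : ∀ k, ρ k ≤ r k) :
    (fun v => f (genericComplex R h₁ h₂ v)) ∈ rankVariety S n b r := by
  refine ⟨map_mem_varietyOfComplexes f (genericComplex_mem R h₁ h₂ h), fun k => ?_⟩
  have : entryMatrix (fun v => f (genericComplex R h₁ h₂ v)) k =
      (leftFactor R h₁ k).map f * (rightFactor R h₂ k).map f := by
    rw [← Matrix.map_mul]
    rfl
  rw [this]
  exact (Matrix.rank_mul_le_left _ _).trans
    ((Matrix.rank_le_card_width _).trans (by simpa using hr k))

namespace MinorIndex

/-- The exponent of the leading monomial, in the variables of the flag matrices, of the leading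
coefficient of a minor of the generic complex. -/
noncomputable def flagExponent (δ : MinorIndex n b) : FlagVar →₀ ℕ :=
  flagExp (δ.arrow + 1) δ.rows + flagExp δ.arrow δ.colsᶜ

/-- The exponent of the leading monomial, in the variables of the diagonal parts, of a minor of the
generic complex. -/
noncomputable def diagExponent (ρ : Fin n → ℕ) (δ : MinorIndex n b) : DiagVar ρ →₀ ℕ :=
  diagExp δ.arrow (firstPositions (ρ δ.arrow) δ.size)

/-- A minor of the generic complex has a leading term in the variables of the diagonal parts, whose
coefficient is a product of minors of two flag matrices and has a leading term with invertible
coefficient. -/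
theorem eval_genericComplex_hasLeadingTerm (δ : MinorIndex n b) (hδ : δ.size ≤ ρ δ.arrow) :
    ∃ (c : R) (p : MvPolynomial FlagVar R), IsUnit c ∧
      MonomialOrder.lex.HasLeadingTerm p δ.flagExponent c ∧
      MonomialOrder.lex.HasLeadingTerm (δ.eval (genericComplex R h₁ h₂)) (δ.diagExponent ρ) p := by
  obtain ⟨c, hc, hQ⟩ := coflagMatrix_det_hasLeadingTerm R δ.arrow δ.cols δ.card_cols
    (hδ.trans (h₂ δ.arrow))
  have hP := flagMatrix_det_hasLeadingTerm R (δ.arrow + 1) δ.rows rfl (hδ.trans (h₁ δ.arrow))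
  refine ⟨1 * c, _, isUnit_one.mul hc, hP.mul hQ, ?_⟩
  have := det_mul_diag_mul_hasLeadingTerm δ.arrow hδ
    ((flagMatrix R (δ.arrow + 1) (b (δ.arrow + 1))).submatrix (δ.rows.orderEmbOfFin rfl)
      (Fin.castLE (h₁ δ.arrow)))
    ((coflagMatrix R δ.arrow (b δ.arrow)).submatrix (fun r => Fin.rev (Fin.castLE (h₂ δ.arrow) r))
      (δ.cols.orderEmbOfFin δ.card_cols))
  exact this

end MinorIndex

end GenericComplex

/-! ### A standard product is determined by its leading exponents -/

namespace Multiset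

variable {α : Type*}

theorem countP_eq_add (T : Multiset α) (p q r : α → Prop) [DecidablePred p] [DecidablePred q]
    [DecidablePred r]
    (h : ∀ x ∈ T, (if p x then 1 else 0) = (if q x then 1 else 0) + if r x then 1 else 0) :
    T.countP p = T.countP q + T.countP r := by
  induction T using Multiset.induction with
  | empty => simp
  | cons a T ih =>
    simp only [countP_cons]
    rw [ih fun x hx => h x (mem_cons_of_mem hx), h a (mem_cons_self a T)]
    omega

theorem countP_le_countP (T : Multiset α) {p q : α → Prop} [DecidablePred p] [DecidablePred q]
    (h : ∀ x ∈ T, p x → q x) : T.countP p ≤ T.countP q := by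
  induction T using Multiset.induction with
  | empty => simp
  | cons a T ih =>
    simp only [countP_cons]
    have h1 := ih fun x hx => h x (mem_cons_of_mem hx)
    have h2 := h a (mem_cons_self a T)
    split_ifs <;> first | omega | tauto

theorem sum_map_apply_eq_countP {σ : Type*} (T : Multiset α) (e : α → σ →₀ ℕ) (x : σ)
    (p : α → Prop) [DecidablePred p] (h : ∀ a ∈ T, e a x = if p a then 1 else 0) :
    (T.map e).sum x = T.countP p := by
  induction T using Multiset.induction with
  | empty => simp
  | cons a T ih =>
    simp only [countP_cons, map_cons, sum_cons, Finsupp.add_apply]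
    rw [ih fun x hx => h x (mem_cons_of_mem hx), h a (mem_cons_self a T), add_comm]

/-- If the subsets of a multiset cut out by some conditions form a chain, then the number of
elements satisfying all of them is the minimum of the numbers of elements satisfying one. -/
theorem countP_forall_eq_iInf {ι : Type*} [Nonempty ι] (T : Multiset α) (P : ι → α → Prop)
    [∀ i, DecidablePred (P i)] [DecidablePred fun x => ∀ i, P i x]
    (h : ∀ i j, (∀ x ∈ T, P i x → P j x) ∨ ∀ x ∈ T, P j x → P i x) :
    T.countP (fun x => ∀ i, P i x) = ⨅ i, T.countP (P i) := by
  obtain ⟨i, hi⟩ : ∃ i, T.countP (P i) = ⨅ i, T.countP (P i) :=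
    Nat.sInf_mem (Set.range_nonempty fun i => T.countP (P i))
  refine le_antisymm (le_ciInf fun j => T.countP_le_countP fun x _ hx => hx j) ?_
  rw [← hi]
  refine T.countP_le_countP fun x hx hPx j => ?_
  rcases h i j with hij | hij
  · exact hij x hx hPx
  · by_contra hne
    have h1 : T.countP (P j) < T.countP (P i) := by
      obtain ⟨T', rfl⟩ := exists_cons_of_mem hx
      rw [countP_cons_of_neg _ hne, countP_cons_of_pos _ hPx]
      exact Nat.lt_succ_of_le (T'.countP_le_countP fun y hy => hij y (mem_cons_of_mem hy))
    have h2 : ⨅ i, T.countP (P i) ≤ T.countP (P j) := ciInf_le' _ _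
    omega

end Multiset

theorem rankBelow_le_card {m : ℕ} (I : Finset (Fin m)) (z : ℕ) : rankBelow I z ≤ I.card :=
  Finset.card_filter_le _ _

theorem rankBelow_le {m : ℕ} (I : Finset (Fin m)) (z : ℕ) : rankBelow I z ≤ z :=
  (Finset.card_le_card (Finset.filter_subset_filter _ (Finset.subset_univ I))).trans
    ((rankBelow_univ m z).trans_le (min_le_left z m))

theorem rankBelow_mono {m : ℕ} (I : Finset (Fin m)) {z z' : ℕ} (h : z ≤ z') :
    rankBelow I z ≤ rankBelow I z' :=
  Finset.card_le_card (Finset.monotone_filter_right _ fun _ _ hx => lt_of_lt_of_le hx h)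

theorem rankBelow_succ {m : ℕ} (I : Finset (Fin m)) (a : Fin m) :
    rankBelow I (a + 1) = rankBelow I a + if a ∈ I then 1 else 0 := by
  have : (I.filter fun x : Fin m => (x : ℕ) < a + 1) =
      (I.filter fun x : Fin m => (x : ℕ) < a) ∪ if a ∈ I then {a} else ∅ := by
    ext x
    split_ifs with h
    · simp only [Finset.mem_filter, Finset.mem_union, Finset.mem_singleton,
        Nat.lt_succ_iff_lt_or_eq, Fin.val_inj]
      constructor
      · tauto
      · rintro (h | rfl) <;> tauto
    · simp only [Finset.mem_filter, Finset.mem_union, Nat.lt_succ_iff_lt_or_eq,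
        Fin.val_inj]
      constructor
      · rintro ⟨h, h' | rfl⟩ <;> simp_all
      · simp
        tauto
  rw [rankBelow, this, Finset.card_union_of_disjoint]
  · split_ifs <;> simp [rankBelow]
  · split_ifs <;> simp

theorem rankBelow_self {m z : ℕ} (I : Finset (Fin m)) (h : m = z) : rankBelow I z = I.card := by
  subst h
  rw [rankBelow, Finset.filter_true_of_mem fun x _ => x.2]

theorem eq_of_rankBelow_eq {m : ℕ} {I J : Finset (Fin m)} (h : ∀ z, rankBelow I z = rankBelow J z) :
    I = J := by
  ext a
  have h1 := rankBelow_succ I a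
  have h2 := rankBelow_succ J a
  rw [h, h] at h1
  by_cases ha : a ∈ I <;> by_cases hb : a ∈ J <;> simp_all

theorem rankBelow_min {m : ℕ} (I : Finset (Fin m)) (z : ℕ) :
    rankBelow I (min z m) = rankBelow I z := by
  rw [rankBelow, rankBelow]
  congr 1
  ext x
  simp

/-- The exponent of the leading monomial of a minor of a flag matrix determines the `k`-th row of
the minor, as soon as the order of the minor is known. -/
theorem sum_flagExp_add {m : ℕ} (w v k z M : ℕ) (I : Finset (Fin m)) (hM : w = v → m ≤ M)
    (hz : k < z) :
    (∑ a ∈ Finset.Ico z M, flagExp w I (flagVar v k a)) +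
      (if w = v ∧ k < rankBelow I z then 1 else 0) = if w = v ∧ k < I.card then 1 else 0 := by
  by_cases hw : w = v
  · subst hw
    simp only [true_and]
    rw [flagExp_eq_sum w I rfl]
    simp only [sum_flagVar_apply w (fun l => I.orderEmbOfFin rfl l)]
    by_cases hk : k < I.card
    · set f := I.orderEmbOfFin rfl with hf
      have hr : rankBelow I (f ⟨k, hk⟩) = k := rankBelow_orderEmbOfFin I rfl ⟨k, hk⟩
      have hlt : (f ⟨k, hk⟩ : ℕ) < M := lt_of_lt_of_le (f ⟨k, hk⟩).2 (hM rfl)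
      rw [if_pos hk]
      by_cases hz' : z ≤ f ⟨k, hk⟩
      · rw [if_neg, Finset.sum_eq_single (f ⟨k, hk⟩ : ℕ), if_pos ⟨hk, by omega, rfl⟩]
        · rintro a - ha
          rw [if_neg]
          rintro ⟨_, _, h⟩
          exact ha h.symm
        · intro h
          exact absurd (Finset.mem_Ico.2 ⟨hz', hlt⟩) h
        · have := rankBelow_mono I hz'
          omega
      · rw [if_pos, Finset.sum_eq_zero]
        · intro a ha
          rw [Finset.mem_Ico] at ha
          rw [if_neg]
          rintro ⟨_, _, h⟩
          omega
        · have h1 := rankBelow_mono I (not_le.1 hz' : (f ⟨k, hk⟩ : ℕ) + 1 ≤ z)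
          rw [rankBelow_succ, if_pos (I.orderEmbOfFin_mem rfl _)] at h1
          omega
    · have := rankBelow_le_card I z
      rw [if_neg (by omega), if_neg hk, Finset.sum_eq_zero]
      intro a _
      rw [if_neg]
      rintro ⟨h, _⟩
      exact hk h
  · rw [flagExp_eq_sum w I rfl, Finset.sum_eq_zero]
    · simp [hw]
    · intro a _
      exact sum_flagVar_apply_of_ne hw (fun l => I.orderEmbOfFin rfl l) k a

namespace MinorIndex

variable {n : ℕ} {b : ℕ → ℕ}

theorem le_trans {δ γ ε : MinorIndex n b} (h : δ ≤ γ) (h' : γ ≤ ε) : δ ≤ ε :=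
  ⟨h.1.trans h'.1, fun z => ⟨(h'.2 z).1.trans (h.2 z).1, (h'.2 z).2.trans (h.2 z).2⟩⟩

theorem le_antisymm {δ γ : MinorIndex n b} (h : δ ≤ γ) (h' : γ ≤ δ) : δ = γ := by
  obtain ⟨k, I, J, hJ, hI⟩ := δ
  obtain ⟨k', I', J', hJ', hI'⟩ := γ
  obtain rfl : k = k' := h.1
  obtain rfl : I = I' := eq_of_rankBelow_eq fun z => _root_.le_antisymm (h'.2 z).1 (h.2 z).1
  obtain rfl : J = J' := eq_of_rankBelow_eq fun z => _root_.le_antisymm (h'.2 z).2 (h.2 z).2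
  rfl

open Classical in
/-- A finite multiset of minors is determined by the numbers of its elements below each minor. -/
theorem multiset_eq_of_countP_le {T T' : Multiset (MinorIndex n b)}
    (h : ∀ δ, T.countP (fun x => x ≤ δ) = T'.countP fun x => x ≤ δ) : T = T' := by
  suffices H : ∀ (N : ℕ) (δ : MinorIndex n b), Nat.card {x // x ≤ δ} = N → T.count δ = T'.count δ
    from Multiset.ext.2 fun δ => H _ δ rfl
  intro N
  induction N using Nat.strong_induction_on with
  | _ N ih =>
    intro δ hδ
    have h1 : T.filter (fun x => x ≤ δ ∧ x ≠ δ) = T'.filter fun x => x ≤ δ ∧ x ≠ δ := by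
      refine Multiset.ext.2 fun x => ?_
      rw [Multiset.count_filter, Multiset.count_filter]
      split_ifs with hx
      · refine ih _ ?_ x rfl
        rw [← hδ]
        have hss : {y | y ≤ x} ⊂ {y | y ≤ δ} :=
          ⟨fun y hy => le_trans hy hx.1, fun hs => hx.2 (le_antisymm hx.1 (hs (le_refl δ)))⟩
        exact Set.ncard_lt_ncard hss (Set.toFinite _)
      · rfl
    have h2 : ∀ S : Multiset (MinorIndex n b), S.countP (fun x => x ≤ δ) =
        S.countP (fun x => δ = x) + S.countP fun x => x ≤ δ ∧ x ≠ δ := fun S =>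
      S.countP_eq_add _ _ _ fun x _ => by
        by_cases hx : x = δ
        · subst hx
          simp [le_refl]
        · simp [hx, Ne.symm hx]
    have h3 := h δ
    rw [h2, h2, Multiset.countP_eq_card_filter (fun x => x ≤ δ ∧ x ≠ δ), h1,
      Multiset.countP_eq_card_filter (fun x => x ≤ δ ∧ x ≠ δ)] at h3
    exact Nat.add_right_cancel h3

/-- The numbers of minors of a given order in a multiset can be read off the exponents. -/
theorem sum_diagExponent_apply {ρ : Fin n → ℕ} (T : Multiset (MinorIndex n b)) (k : Fin n)
    (r : Fin (ρ k)) : (T.map (diagExponent ρ)).sum (diagVar k r) =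
      T.countP fun δ => δ.arrow = k ∧ (r : ℕ) < δ.size := by
  refine T.sum_map_apply_eq_countP _ _ _ fun δ _ => ?_
  rw [diagExponent]
  by_cases h : δ.arrow = k
  · subst h
    rw [diagExp_apply_self]
    simp [mem_firstPositions]
  · rw [diagExp_apply_of_ne (Ne.symm h), if_neg fun h' => h h'.1]

theorem countP_size_eq {ρ : Fin n → ℕ} {T T' : Multiset (MinorIndex n b)}
    (hT : ∀ δ ∈ T, δ.size ≤ ρ δ.arrow) (hT' : ∀ δ ∈ T', δ.size ≤ ρ δ.arrow)
    (h : (T.map (diagExponent ρ)).sum = (T'.map (diagExponent ρ)).sum) (v r : ℕ) :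
    T.countP (fun δ => (δ.arrow : ℕ) = v ∧ r < δ.size) =
      T'.countP fun δ => (δ.arrow : ℕ) = v ∧ r < δ.size := by
  by_cases hv : ∃ k : Fin n, (k : ℕ) = v ∧ r < ρ k
  · obtain ⟨k, rfl, hr⟩ := hv
    simp only [Fin.val_inj]
    rw [← sum_diagExponent_apply T k ⟨r, hr⟩, ← sum_diagExponent_apply T' k ⟨r, hr⟩, h]
  · have : ∀ S : Multiset (MinorIndex n b), (∀ δ ∈ S, δ.size ≤ ρ δ.arrow) →
        S.countP (fun δ => (δ.arrow : ℕ) = v ∧ r < δ.size) = 0 := fun S hS => by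
      rw [Multiset.countP_eq_zero]
      rintro δ hδ ⟨h1, h2⟩
      exact hv ⟨δ.arrow, h1, lt_of_lt_of_le h2 (hS δ hδ)⟩
    rw [this T hT, this T' hT']

theorem sum_flagExponent_add (T : Multiset (MinorIndex n b)) (v k z : ℕ) (hz : k < z) :
    (∑ a ∈ Finset.Ico z (b v), (T.map flagExponent).sum (flagVar v k a)) +
      (T.countP (fun δ => (δ.arrow : ℕ) + 1 = v ∧ k < rankBelow δ.rows z) +
        T.countP (fun δ => (δ.arrow : ℕ) = v ∧ k < rankBelow δ.colsᶜ z)) =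
      T.countP (fun δ => (δ.arrow : ℕ) + 1 = v ∧ k < δ.size) +
        T.countP (fun δ => (δ.arrow : ℕ) = v ∧ k < b v - δ.size) := by
  induction T using Multiset.induction with
  | empty => simp
  | cons δ T ih =>
    simp only [Multiset.map_cons, Multiset.sum_cons, Finsupp.add_apply, Multiset.countP_cons,
      Finset.sum_add_distrib, flagExponent]
    have h1 := sum_flagExp_add (δ.arrow + 1) v k z (b v) δ.rows
      (fun h => by rw [h]) hz
    have h2 := sum_flagExp_add δ.arrow v k z (b v) δ.colsᶜ (fun h => by rw [h]) hz
    have h3 : ((δ.arrow : ℕ) = v ∧ k < δ.colsᶜ.card) ↔ ((δ.arrow : ℕ) = v ∧ k < b v - δ.size) := by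
      refine and_congr_right fun h => ?_
      rw [Finset.card_compl, Fintype.card_fin, δ.card_cols, ← h]
      rfl
    rw [if_congr h3 rfl rfl] at h2
    rw [show δ.rows.card = δ.size from rfl] at h1
    omega

/-- In a standard multiset, the complements of the columns of the minors of one matrix dominate the
rows of the minors of the preceding matrix, so that their ranks are the largest ones. -/
theorem Standard.countP_compl_cols_eq_min {T : Multiset (MinorIndex n b)} (hT : Standard T)
    (v k z : ℕ) :
    T.countP (fun δ => (δ.arrow : ℕ) = v ∧ k < rankBelow δ.colsᶜ z) =
      min (T.countP (fun δ => (δ.arrow : ℕ) + 1 = v ∧ k < rankBelow δ.rows z) +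
        T.countP (fun δ => (δ.arrow : ℕ) = v ∧ k < rankBelow δ.colsᶜ z))
        (T.countP fun δ => (δ.arrow : ℕ) = v ∧ 0 < δ.size) := by
  have h1 : T.countP (fun δ => (δ.arrow : ℕ) = v ∧ k < rankBelow δ.colsᶜ z) ≤
      T.countP fun δ => (δ.arrow : ℕ) = v ∧ 0 < δ.size :=
    T.countP_le_countP fun δ _ h => ⟨h.1, δ.rows_pos⟩
  rcases Nat.eq_zero_or_pos
    (T.countP (fun δ => (δ.arrow : ℕ) + 1 = v ∧ k < rankBelow δ.rows z)) with h0 | h0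
  · omega
  · have h2 : T.countP (fun δ => (δ.arrow : ℕ) = v ∧ 0 < δ.size) ≤
        T.countP (fun δ => (δ.arrow : ℕ) = v ∧ k < rankBelow δ.colsᶜ z) := by
      obtain ⟨δ, hδ, hv, hk⟩ := Multiset.countP_pos.1 h0
      refine T.countP_le_countP fun γ hγ h => ⟨h.1, ?_⟩
      have h3 := (hT δ hδ γ hγ).2 (by omega) (min z (b γ.arrow))
      have h4 : rankBelow δ.rows (min z (b γ.arrow)) = rankBelow δ.rows z := by
        have : b γ.arrow = b (δ.arrow + 1) := by congr 1; omega
        rw [this, rankBelow_min]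
      have h5 := rankBelow_add_compl γ.cols z
      rw [rankBelow_min, h4] at h3
      omega
    omega

/-- The number of elements of a multiset of minors of one matrix below a given minor is the minimum
of the numbers of elements satisfying one of the inequalities that define the order. -/
theorem Standard.countP_le_eq_iInf {T : Multiset (MinorIndex n b)} (hT : Standard T)
    (δ : MinorIndex n b) [DecidablePred fun x : MinorIndex n b => x ≤ δ] :
    T.countP (fun x => x ≤ δ) = ⨅ c : ℕ ⊕ ℕ, c.elim
      (fun z => T.countP fun x => (x.arrow : ℕ) = δ.arrow ∧ rankBelow δ.rows z ≤ rankBelow x.rows z)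
      (fun z => T.countP fun x => (x.arrow : ℕ) = δ.arrow ∧
        rankBelow δ.cols z ≤ rankBelow x.cols z) := by
  classical
  let P : ℕ ⊕ ℕ → MinorIndex n b → Prop := fun c x => c.elim
    (fun z => (x.arrow : ℕ) = δ.arrow ∧ rankBelow δ.rows z ≤ rankBelow x.rows z)
    (fun z => (x.arrow : ℕ) = δ.arrow ∧ rankBelow δ.cols z ≤ rankBelow x.cols z)
  have h1 := T.countP_forall_eq_iInf P fun c c' => by
    by_contra hne
    push Not at hne
    obtain ⟨⟨x, hx, hPx, hnx⟩, y, hy, hPy, hny⟩ := hne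
    have harrow : ∀ {c x}, P c x → (x.arrow : ℕ) = δ.arrow := by
      rintro (z | z) x h <;> exact h.1
    have hxy : x.arrow = y.arrow := Fin.ext ((harrow hPx).trans (harrow hPy).symm)
    have hmono : ∀ {c x y}, x ≤ y → P c y → P c x := by
      rintro (z | z) x y hle h
      · exact ⟨(congrArg Fin.val hle.1).trans h.1, h.2.trans (hle.2 z).1⟩
      · exact ⟨(congrArg Fin.val hle.1).trans h.1, h.2.trans (hle.2 z).2⟩
    rcases (hT x hx y hy).1 hxy with h | h
    · exact hnx (hmono h hPy)
    · exact hny (hmono h hPx)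
  have h2 : ∀ x : MinorIndex n b, x ≤ δ ↔ ∀ c, P c x := by
    intro x
    rw [le_def]
    constructor
    · rintro ⟨h, h'⟩ (z | z)
      · exact ⟨congrArg Fin.val h, (h' z).1⟩
      · exact ⟨congrArg Fin.val h, (h' z).2⟩
    · intro h
      exact ⟨Fin.ext (h (Sum.inl 0)).1, fun z => ⟨(h (Sum.inl z)).2, (h (Sum.inr z)).2⟩⟩
  rw [Multiset.countP_congr rfl fun x _ => propext (h2 x), h1]
  congr 1
  ext (z | z) <;> exact Multiset.countP_congr rfl fun _ _ => rfl

/-- A standard multiset of minors is determined by the exponents of the leading monomial of the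
corresponding product of minors of the generic complex. -/
theorem Standard.eq_of_exponents_eq {ρ : Fin n → ℕ} {T T' : Multiset (MinorIndex n b)}
    (hT : Standard T) (hT' : Standard T')
    (hs : ∀ δ ∈ T, δ.size ≤ ρ δ.arrow) (hs' : ∀ δ ∈ T', δ.size ≤ ρ δ.arrow)
    (h : (T.map (diagExponent ρ)).sum = (T'.map (diagExponent ρ)).sum)
    (h' : (T.map flagExponent).sum = (T'.map flagExponent).sum) : T = T' := by
  classical
  have hsize := countP_size_eq hs hs' h
  have hrow : ∀ v k, T.countP (fun δ => (δ.arrow : ℕ) + 1 = v ∧ k < δ.size) =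
      T'.countP fun δ => (δ.arrow : ℕ) + 1 = v ∧ k < δ.size := by
    rintro (_ | v) k
    · simp
    · simpa using hsize v k
  have hcard : ∀ v, T.countP (fun δ => (δ.arrow : ℕ) = v) =
      T'.countP fun δ => (δ.arrow : ℕ) = v := fun v => by
    have := hsize v 0
    rwa [Multiset.countP_congr rfl fun x _ => propext (and_iff_left x.rows_pos),
      Multiset.countP_congr rfl fun x _ => propext (and_iff_left x.rows_pos)] at this
  have hcosize : ∀ v k, T.countP (fun δ => (δ.arrow : ℕ) = v ∧ k < b v - δ.size) =
      T'.countP fun δ => (δ.arrow : ℕ) = v ∧ k < b v - δ.size := by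
    intro v k
    by_cases hk : k < b v
    · have key : ∀ S : Multiset (MinorIndex n b), S.countP (fun δ => (δ.arrow : ℕ) = v) =
          S.countP (fun δ => (δ.arrow : ℕ) = v ∧ k < b v - δ.size) +
            S.countP fun δ => (δ.arrow : ℕ) = v ∧ b v - k - 1 < δ.size := fun S =>
        S.countP_eq_add _ _ _ fun x _ => by
          by_cases h1 : (x.arrow : ℕ) = v <;> by_cases h2 : k < b v - x.size
          · rw [if_pos h1, if_pos ⟨h1, h2⟩, if_neg (by omega)]
          · rw [if_pos h1, if_neg (by omega), if_pos (by omega)]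
          · rw [if_neg h1, if_neg (by omega), if_neg (by omega)]
          · rw [if_neg h1, if_neg (by omega), if_neg (by omega)]
      have h1 := key T
      have h2 := key T'
      have h3 := hcard v
      have h4 := hsize v (b v - k - 1)
      omega
    · rw [Multiset.countP_eq_zero.2 (by rintro x - ⟨_, h⟩; omega),
        Multiset.countP_eq_zero.2 (by rintro x - ⟨_, h⟩; omega)]
  have hboth : ∀ v k z, T.countP (fun δ => (δ.arrow : ℕ) + 1 = v ∧ k < rankBelow δ.rows z) +
        T.countP (fun δ => (δ.arrow : ℕ) = v ∧ k < rankBelow δ.colsᶜ z) =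
      T'.countP (fun δ => (δ.arrow : ℕ) + 1 = v ∧ k < rankBelow δ.rows z) +
        T'.countP (fun δ => (δ.arrow : ℕ) = v ∧ k < rankBelow δ.colsᶜ z) := by
    intro v k z
    by_cases hz : k < z
    · have h1 := sum_flagExponent_add T v k z hz
      have h2 := sum_flagExponent_add T' v k z hz
      rw [h'] at h1
      have h3 := hrow v k
      have h4 := hcosize v k
      omega
    · have h0 : ∀ {m : ℕ} (I : Finset (Fin m)), ¬ k < rankBelow I z := fun I => by
        have := rankBelow_le I z
        omega
      simp [h0]
  have hcc : ∀ v k z, T.countP (fun δ => (δ.arrow : ℕ) = v ∧ k < rankBelow δ.colsᶜ z) =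
      T'.countP fun δ => (δ.arrow : ℕ) = v ∧ k < rankBelow δ.colsᶜ z := fun v k z => by
    rw [hT.countP_compl_cols_eq_min, hT'.countP_compl_cols_eq_min, hboth, hsize]
  have hrr : ∀ v j z, T.countP (fun δ => (δ.arrow : ℕ) = v ∧ j ≤ rankBelow δ.rows z) =
      T'.countP fun δ => (δ.arrow : ℕ) = v ∧ j ≤ rankBelow δ.rows z := by
    rintro v (_ | j) z
    · simpa using hcard v
    · have h1 := hboth (v + 1) j z
      rw [hcc] at h1
      simpa [Nat.succ_le_iff] using Nat.add_right_cancel h1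
  have hjj : ∀ v j z, T.countP (fun δ => (δ.arrow : ℕ) = v ∧ j ≤ rankBelow δ.cols z) =
      T'.countP fun δ => (δ.arrow : ℕ) = v ∧ j ≤ rankBelow δ.cols z := by
    intro v j z
    by_cases hj : j ≤ min z (b v)
    · have key : ∀ S : Multiset (MinorIndex n b), S.countP (fun δ => (δ.arrow : ℕ) = v) =
          S.countP (fun δ => (δ.arrow : ℕ) = v ∧ j ≤ rankBelow δ.cols z) +
            S.countP fun δ => (δ.arrow : ℕ) = v ∧ min z (b v) - j < rankBelow δ.colsᶜ z := fun S =>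
        S.countP_eq_add _ _ _ fun x _ => by
          by_cases h1 : (x.arrow : ℕ) = v
          · have h3 := rankBelow_add_compl x.cols z
            have h4 : b x.arrow = b v := congrArg b h1
            by_cases h2 : j ≤ rankBelow x.cols z
            · rw [if_pos h1, if_pos ⟨h1, h2⟩, if_neg (by omega)]
            · rw [if_pos h1, if_neg (by omega), if_pos (by omega)]
          · rw [if_neg h1, if_neg (by omega), if_neg (by omega)]
      have h1 := key T
      have h2 := key T'
      have h3 := hcard v
      have h4 := hcc v (min z (b v) - j) z
      omega
    · have h0 : ∀ S : Multiset (MinorIndex n b),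
          S.countP (fun δ => (δ.arrow : ℕ) = v ∧ j ≤ rankBelow δ.cols z) = 0 := fun S => by
        rw [Multiset.countP_eq_zero]
        rintro x - ⟨h1, h2⟩
        have h3 := rankBelow_add_compl x.cols z
        have h4 : b x.arrow = b v := congrArg b h1
        omega
      rw [h0, h0]
  refine multiset_eq_of_countP_le fun δ => ?_
  rw [hT.countP_le_eq_iInf, hT'.countP_le_eq_iInf]
  simp only [hrr, hjj]

end MinorIndex

/-! ### Vanishing ideals -/

theorem minor_mem_minorIdeal {K : Type*} [CommRing K] {n : ℕ} {b : ℕ → ℕ} {r : Fin n → ℕ}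
    (δ : MinorIndex n b) (h : r δ.arrow < δ.size) : δ.poly K ∈ minorIdeal K n b r := by
  rw [← Ideal.Quotient.eq_zero_iff_mem, MinorIndex.poly, MinorIndex.eval, Matrix.minor,
    RingHom.map_det]
  refine Matrix.det_eq_zero_of_rows_minors_eq_zero (k := r δ.arrow + 1) _
    (Fin.castLE h) (Fin.castLE_injective h) fun g => ?_
  rw [RingHom.mapMatrix_apply, Matrix.submatrix_map, ← RingHom.mapMatrix_apply, ← RingHom.map_det,
    Ideal.Quotient.eq_zero_iff_mem, Matrix.submatrix_submatrix]
  refine Matrix.det_submatrix_mem _ _ _ _ fun hf hg => ?_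
  exact Ideal.subset_span ⟨δ.arrow, _, _, rfl⟩

theorem prodPoly_mem_minorIdeal {K : Type*} [CommRing K] {n : ℕ} {b : ℕ → ℕ} {r : Fin n → ℕ}
    {T : Multiset (MinorIndex n b)} (h : ∃ δ ∈ T, r δ.arrow < δ.size) :
    MinorIndex.prodPoly K T ∈ minorIdeal K n b r := by
  obtain ⟨δ, hδ, hr⟩ := h
  obtain ⟨T, rfl⟩ := Multiset.exists_cons_of_mem hδ
  rw [MinorIndex.prodPoly_cons]
  exact Ideal.mul_mem_right _ _ (minor_mem_minorIdeal δ hr)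

section Points

variable {K R : Type*} [CommRing K] [CommRing R] [Algebra K R] {n : ℕ} {b : ℕ → ℕ}

theorem aeval_det_genericMatrix {s : ℕ} (y : EntryIndex n b → R) (k : Fin n)
    (f : Fin s → Fin (b (k + 1))) (g : Fin s → Fin (b k)) :
    aeval y ((genericMatrix K n b k).submatrix f g).det =
      ((entryMatrix y k).submatrix f g).det := by
  rw [AlgHom.map_det]
  congr 1
  ext i j
  simp [genericMatrix, entryMatrix]

theorem MinorIndex.aeval_poly (y : EntryIndex n b → R) (δ : MinorIndex n b) :
    aeval y (δ.poly K) = δ.eval y :=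
  aeval_det_genericMatrix y _ _ _

theorem MinorIndex.aeval_prodPoly (y : EntryIndex n b → R) (T : Multiset (MinorIndex n b)) :
    aeval y (prodPoly K T) = (T.map fun δ => δ.eval y).prod := by
  rw [prodPoly, map_multiset_prod, Multiset.map_map]
  simp only [Function.comp_def, aeval_poly]

theorem complexIdeal_le_vanishingIdeal :
    complexIdeal K n b ≤ vanishingIdealOfPoints K (varietyOfComplexes R n b) := by
  refine Ideal.span_le.2 ?_
  rintro _ ⟨k, h, i, j, rfl⟩ y hy
  have h1 := congrFun (congrFun (hy k h) i) j
  rw [Matrix.mul_apply, map_sum]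
  rw [Matrix.mul_apply, Matrix.zero_apply] at h1
  simpa [genericMatrix, entryMatrix] using h1

theorem minorIdeal_le_vanishingIdeal [IsDomain R] (r : Fin n → ℕ) :
    minorIdeal K n b r ≤ vanishingIdealOfPoints K (rankVariety R n b r) := by
  refine Ideal.span_le.2 ?_
  rintro _ ⟨k, s, t, rfl⟩ y hy
  rw [aeval_det_genericMatrix]
  by_contra hne
  have h1 := Matrix.rank_of_det_ne_zero hne
  have h2 := Matrix.rank_submatrix_le (entryMatrix y k) s t
  have h3 := hy.2 k
  rw [h1, Fintype.card_fin] at h2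
  omega

/-- Over an infinite domain, a polynomial with polynomial coefficients vanishes if all its values
do. -/
theorem MvPolynomial.eq_zero_of_forall_eval_map_eval_eq_zero {σ τ : Type*} [IsDomain R] [Infinite R]
    (q : MvPolynomial σ (MvPolynomial τ R))
    (h : ∀ (u : σ → R) (w : τ → R), MvPolynomial.eval u (map (MvPolynomial.eval w) q) = 0) :
    q = 0 := by
  ext d : 1
  refine MvPolynomial.funext fun w => ?_
  have h1 : map (MvPolynomial.eval w) q = 0 := MvPolynomial.funext fun u => by rw [h, map_zero]
  rw [← coeff_map, h1]
  simp

end Points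

namespace MinorIndex

variable {n : ℕ} {b : ℕ → ℕ}

/-- The largest order of a minor of the `k`-th matrix in a multiset of minors. -/
noncomputable def maxSize (T : Multiset (MinorIndex n b)) (k : Fin n) : ℕ :=
  (T.map fun δ => if δ.arrow = k then δ.size else 0).sup

theorem maxSize_le_iff {T : Multiset (MinorIndex n b)} {k : Fin n} {N : ℕ} :
    maxSize T k ≤ N ↔ ∀ δ ∈ T, δ.arrow = k → δ.size ≤ N := by
  rw [maxSize, Multiset.sup_le]
  simp only [Multiset.mem_map, forall_exists_index, and_imp]
  constructor
  · rintro h δ hδ rfl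
    simpa using h _ δ hδ rfl
  · rintro h _ δ hδ rfl
    split_ifs with hk
    · exact h δ hδ hk
    · exact Nat.zero_le _

theorem size_le_maxSize {T : Multiset (MinorIndex n b)} {δ : MinorIndex n b} (hδ : δ ∈ T) :
    δ.size ≤ maxSize T δ.arrow :=
  maxSize_le_iff.1 _root_.le_rfl δ hδ rfl

theorem size_le_succ (δ : MinorIndex n b) : δ.size ≤ b (δ.arrow + 1) := by
  simpa [size] using Finset.card_le_univ δ.rows

theorem size_le (δ : MinorIndex n b) : δ.size ≤ b δ.arrow := by
  simpa [size, δ.card_cols] using Finset.card_le_univ δ.cols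

/-- Compatibility at `z = b (k + 1)` bounds the sum of the orders of minors of adjacent matrices, so
that there are complexes of ranks given by the largest orders. -/
theorem Standard.maxSize_add_maxSize_le {T : Multiset (MinorIndex n b)} (hT : Standard T) (k : ℕ)
    (hk : k + 1 < n) :
    maxSize T ⟨k, Nat.lt_of_succ_lt hk⟩ + maxSize T ⟨k + 1, hk⟩ ≤ b (k + 1) := by
  have h1 : maxSize T ⟨k, Nat.lt_of_succ_lt hk⟩ ≤ b (k + 1) :=
    maxSize_le_iff.2 fun δ _ h => by
      have := size_le_succ δ
      rwa [h] at this
  have h2 : maxSize T ⟨k + 1, hk⟩ ≤ b (k + 1) - maxSize T ⟨k, Nat.lt_of_succ_lt hk⟩ := by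
    refine maxSize_le_iff.2 fun γ hγ hγk => ?_
    have h3 : γ.size ≤ b (k + 1) := by
      have := size_le γ
      rwa [hγk] at this
    have h4 : maxSize T ⟨k, Nat.lt_of_succ_lt hk⟩ ≤ b (k + 1) - γ.size := by
      refine maxSize_le_iff.2 fun δ hδ hδk => ?_
      have h5 := (hT δ hδ γ hγ).2 (by rw [hδk, hγk]) (b (k + 1))
      rw [rankBelow_self δ.rows (by rw [hδk]), rankBelow_self γ.cols (by rw [hγk]),
        γ.card_cols] at h5
      simp only [size]
      omega
    omega
  omega

variable (R : Type*) [CommRing R] {ρ : Fin n → ℕ}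
  (h₁ : ∀ k : Fin n, ρ k ≤ b (k + 1)) (h₂ : ∀ k : Fin n, ρ k ≤ b k)

theorem eval_genericComplex_eq_zero (δ : MinorIndex n b) (hδ : ρ δ.arrow < δ.size) :
    δ.eval (genericComplex R h₁ h₂) = 0 := by
  have h : δ.eval (genericComplex R h₁ h₂) =
      ((leftFactor R h₁ δ.arrow).submatrix (δ.rows.orderEmbOfFin rfl) id *
        (rightFactor R h₂ δ.arrow).submatrix id (δ.cols.orderEmbOfFin δ.card_cols)).det := rfl
  rw [h, Matrix.det_mul_eq_sum_prod_mul_det]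
  refine Finset.sum_eq_zero fun f _ => ?_
  obtain ⟨i, j, hij, hf⟩ := Fintype.exists_ne_map_eq_of_card_lt f (by simpa [size] using hδ)
  rw [Matrix.det_zero_of_row_eq hij, mul_zero]
  ext x
  simp [hf]

/-- The leading terms of a standard product of minors of the generic complex. -/
theorem prod_eval_genericComplex_hasLeadingTerm (T : Multiset (MinorIndex n b))
    (hT : ∀ δ ∈ T, δ.size ≤ ρ δ.arrow) :
    ∃ (c : R) (p : MvPolynomial FlagVar R), IsUnit c ∧
      MonomialOrder.lex.HasLeadingTerm p (T.map flagExponent).sum c ∧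
      MonomialOrder.lex.HasLeadingTerm (T.map fun δ => δ.eval (genericComplex R h₁ h₂)).prod
        (T.map (diagExponent ρ)).sum p := by
  choose! c p hc hp hq using
    fun δ : MinorIndex n b => eval_genericComplex_hasLeadingTerm R h₁ h₂ δ
  refine ⟨(T.map c).prod, (T.map p).prod, ?_, ?_, ?_⟩
  · clear hp hq
    induction T using Multiset.induction with
    | empty => simp
    | cons δ T ih =>
      rw [Multiset.map_cons, Multiset.prod_cons]
      exact (hc δ (hT δ (Multiset.mem_cons_self _ _))).mul
        (ih fun γ hγ => hT γ (Multiset.mem_cons_of_mem hγ))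
  · exact MonomialOrder.HasLeadingTerm.multiset_prod T p _ c fun δ hδ => hp δ (hT δ hδ)
  · exact MonomialOrder.HasLeadingTerm.multiset_prod T _ _ p fun δ hδ => hq δ (hT δ hδ)

/-- The standard products of minors whose orders respect the rank conditions are linearly
independent modulo the polynomials vanishing on the complexes that satisfy these conditions. -/
theorem eq_zero_of_linearCombination_mem_vanishingIdeal {K R : Type*} [CommRing K] [CommRing R]
    [IsDomain R] [Infinite R] [Algebra K R] (hKR : Function.Injective (algebraMap K R))
    {r : Fin n → ℕ} (l : Multiset (MinorIndex n b) →₀ K)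
    (hl : ∀ T ∈ l.support, Standard T ∧ ∀ δ ∈ T, δ.size ≤ r δ.arrow)
    (h : Finsupp.linearCombination K (prodPoly K) l ∈
      vanishingIdealOfPoints K (rankVariety R n b r)) : l = 0 := by
  classical
  by_contra hne
  obtain ⟨T₀, hT₀⟩ := Finsupp.support_nonempty_iff.2 hne
  -- The ranks of the generic complex are the smallest for which `T₀` does not vanish on it.
  let ρ := maxSize T₀
  have h₁ : ∀ k : Fin n, ρ k ≤ b (k + 1) := fun k =>
    maxSize_le_iff.2 fun δ _ hδ => hδ ▸ size_le_succ δ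
  have h₂ : ∀ k : Fin n, ρ k ≤ b k := fun k => maxSize_le_iff.2 fun δ _ hδ => hδ ▸ size_le δ
  have hρr : ∀ k, ρ k ≤ r k := fun k =>
    maxSize_le_iff.2 fun δ hδ hk => hk ▸ (hl T₀ hT₀).2 δ hδ
  set Φ := genericComplex R h₁ h₂ with hΦ
  have hzero : aeval Φ (Finsupp.linearCombination K (prodPoly K) l) = 0 := by
    refine MvPolynomial.eq_zero_of_forall_eval_map_eval_eq_zero _ fun u w => ?_
    have h3 := h _ (map_genericComplex_mem_rankVariety R h₁ h₂
      ((MvPolynomial.eval u).comp (map (MvPolynomial.eval w)))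
      (hl T₀ hT₀).1.maxSize_add_maxSize_le hρr)
    rw [← h3]
    have h4 : ∀ q : MvPolynomial (EntryIndex n b) K,
        ((MvPolynomial.eval u).comp (map (MvPolynomial.eval w))) (aeval Φ q) =
          aeval (fun v => ((MvPolynomial.eval u).comp (map (MvPolynomial.eval w))) (Φ v)) q := by
      intro q
      induction q using MvPolynomial.induction_on with
      | C a => simp [MvPolynomial.algebraMap_apply]
      | add p q hp hq => rw [map_add, map_add, map_add, hp, hq]
      | mul_X p v hp => rw [map_mul, map_mul, map_mul, hp, aeval_X, aeval_X]
    exact h4 _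
  let s := l.support.filter fun T => ∀ δ ∈ T, δ.size ≤ ρ δ.arrow
  have hsum : ∑ T ∈ s, l T • (T.map fun δ : MinorIndex n b => δ.eval Φ).prod = 0 := by
    rw [← hzero, Finsupp.linearCombination_apply, Finsupp.sum, map_sum, Finset.sum_filter]
    refine Finset.sum_congr rfl fun T _ => ?_
    rw [map_smul, aeval_prodPoly]
    split_ifs with hT
    · rfl
    · push Not at hT
      obtain ⟨δ, hδ, hlt⟩ := hT
      rw [Multiset.prod_eq_zero, smul_zero]
      exact Multiset.mem_map.2 ⟨δ, hδ, eval_genericComplex_eq_zero R h₁ h₂ δ hlt⟩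
  choose! c p hc hp hq using prod_eval_genericComplex_hasLeadingTerm R h₁ h₂
  -- Leading exponents are compared first in the diagonal variables, then in those of the flags.
  let key : Multiset (MinorIndex n b) → _ := fun T =>
    toLex ((MonomialOrder.lex (σ := DiagVar ρ)).toSyn (T.map (diagExponent ρ)).sum,
      (MonomialOrder.lex (σ := FlagVar)).toSyn (T.map flagExponent).sum)
  obtain ⟨T₁, hT₁, hmax⟩ := s.exists_max_image key
    ⟨T₀, Finset.mem_filter.2 ⟨hT₀, fun δ hδ => size_le_maxSize hδ⟩⟩
  have hs : ∀ T ∈ s, Standard T ∧ ∀ δ ∈ T, δ.size ≤ ρ δ.arrow := fun T hT =>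
    ⟨(hl T (Finset.mem_filter.1 hT).1).1, (Finset.mem_filter.1 hT).2⟩
  have hcoeff : ∀ T ∈ s, T ≠ T₁ → (((T.map fun δ : MinorIndex n b => δ.eval Φ).prod).coeff
      (T₁.map (diagExponent ρ)).sum).coeff (T₁.map flagExponent).sum = 0 := by
    intro T hT hTne
    rcases (Prod.Lex.toLex_le_toLex.1 (hmax T hT)) with hlt | ⟨heq, hle⟩
    · rw [(hq T (hs T hT).2).coeff_eq_zero_of_lt hlt, coeff_zero]
    · have heq' := MonomialOrder.lex.toSyn.injective heq
      rw [← heq', (hq T (hs T hT).2).2]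
      refine (hp T (hs T hT).2).coeff_eq_zero_of_lt (lt_of_le_of_ne hle fun h' => hTne ?_)
      exact (hs T hT).1.eq_of_exponents_eq (hs T₁ hT₁).1 (hs T hT).2 (hs T₁ hT₁).2 heq'
        (MonomialOrder.lex.toSyn.injective h')
  have hfinal := congrArg (fun q => (q.coeff (T₁.map (diagExponent ρ)).sum).coeff
    (T₁.map flagExponent).sum) hsum
  simp only [coeff_sum, coeff_smul, coeff_zero] at hfinal
  rw [Finset.sum_eq_single T₁ (fun T hT hTne => by rw [hcoeff T hT hTne, smul_zero])
    (fun h' => absurd hT₁ h'), (hq T₁ (hs T₁ hT₁).2).2, (hp T₁ (hs T₁ hT₁).2).2,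
    Algebra.smul_def, (hc T₁ (hs T₁ hT₁).2).mul_left_eq_zero] at hfinal
  have := hKR (hfinal.trans (map_zero _).symm)
  exact Finsupp.mem_support_iff.1 (Finset.mem_filter.1 hT₁).1 this

end MinorIndex

/-- A vanishing polynomial is modulo the two ideals a combination of standard products of minors
whose orders respect the rank conditions, and these are linearly independent. -/
theorem vanishingIdeal_rankVariety {K R : Type*} [CommRing K] [CommRing R] [IsDomain R] [Infinite R]
    [Algebra K R] (hKR : Function.Injective (algebraMap K R)) (n : ℕ) (b : ℕ → ℕ) (r : Fin n → ℕ) :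
    vanishingIdealOfPoints K (rankVariety R n b r) = complexIdeal K n b ⊔ minorIdeal K n b r := by
  classical
  have hle : complexIdeal K n b ⊔ minorIdeal K n b r ≤
      vanishingIdealOfPoints K (rankVariety R n b r) :=
    sup_le (complexIdeal_le_vanishingIdeal.trans fun p hp y hy => hp y hy.1)
      (minorIdeal_le_vanishingIdeal r)
  refine le_antisymm (fun p hp => ?_) hle
  have h1 : p ∈ MinorIndex.standardSpan K n b := by
    rw [MinorIndex.standardSpan_eq_top]
    trivial
  obtain ⟨p₀, hp₀, q, hq, rfl⟩ := Submodule.mem_sup.1 h1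
  obtain ⟨l, hl, rfl⟩ := (Finsupp.mem_span_image_iff_linearCombination K).1 hq
  let good : Multiset (MinorIndex n b) → Prop := fun T => ∀ δ ∈ T, δ.size ≤ r δ.arrow
  have hbad : Finsupp.linearCombination K (MinorIndex.prodPoly K) (l.filter fun T => ¬ good T) ∈
      minorIdeal K n b r := by
    rw [Finsupp.linearCombination_apply]
    refine sum_mem fun T hT => ?_
    rw [Finsupp.support_filter, Finset.mem_filter] at hT
    have h2 := hT.2
    simp only [good] at h2
    push Not at h2
    exact Submodule.smul_of_tower_mem _ _ (prodPoly_mem_minorIdeal h2)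
  rw [← Finsupp.filter_add_filter_not l good, map_add] at hp ⊢
  have hgood : l.filter good = 0 := by
    refine MinorIndex.eq_zero_of_linearCombination_mem_vanishingIdeal hKR (r := r) _
      (fun T hT => ?_) ?_
    · rw [Finsupp.support_filter, Finset.mem_filter] at hT
      exact ⟨hl hT.1, hT.2⟩
    · have h3 := hle (Ideal.mem_sup_left (Submodule.restrictScalars_mem K _ _ |>.1 hp₀))
      have h4 := hle (Ideal.mem_sup_right hbad)
      have h5 := sub_mem (sub_mem hp h3) h4
      rwa [add_sub_cancel_left, add_sub_cancel_right] at h5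
  rw [hgood, map_zero, zero_add]
  exact add_mem (Ideal.mem_sup_left hp₀) (Ideal.mem_sup_right hbad)

theorem minorIdeal_eq_bot (K : Type*) [CommRing K] (n : ℕ) (b : ℕ → ℕ) :
    minorIdeal K n b (fun k => b k) = ⊥ := by
  rw [minorIdeal, Ideal.span_eq_bot]
  rintro _ ⟨k, s, t, rfl⟩
  have := Fintype.card_le_of_injective t t.injective
  simp at this

/-- The variety of complexes as the special case of rank conditions that hold automatically. -/
theorem rankVariety_eq_varietyOfComplexes (R : Type*) [CommRing R] [Nontrivial R] (n : ℕ)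
    (b : ℕ → ℕ) : rankVariety R n b (fun k => b k) = varietyOfComplexes R n b :=
  Set.ext fun _ => ⟨fun h => h.1, fun h => ⟨h, fun _ => Matrix.rank_le_width _⟩⟩

theorem vanishingIdeal_varietyOfComplexes {K R : Type*} [CommRing K] [CommRing R] [IsDomain R]
    [Infinite R] [Algebra K R] (hKR : Function.Injective (algebraMap K R)) (n : ℕ) (b : ℕ → ℕ) :
    vanishingIdealOfPoints K (varietyOfComplexes R n b) = complexIdeal K n b := by
  rw [← rankVariety_eq_varietyOfComplexes, vanishingIdeal_rankVariety hKR, minorIdeal_eq_bot,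
    sup_bot_eq]

theorem mainTheorem2 {K R : Type*} [CommRing K] [CommRing R] [IsDomain R] [Infinite R]
    [Algebra K R] (hKR : Function.Injective (algebraMap K R))
    (n : ℕ) (b : ℕ → ℕ) (r : Fin n → ℕ) :
    (∃ e : CoordinateRing K (varietyOfComplexes R n b) ≃ₐ[K]
        (MvPolynomial (EntryIndex n b) K ⧸ complexIdeal K n b),
      ∀ p : MvPolynomial (EntryIndex n b) K,
        e (Ideal.Quotient.mk (vanishingIdealOfPoints K (varietyOfComplexes R n b)) p) =
          Ideal.Quotient.mk (complexIdeal K n b) p) ∧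
    (∃ e : CoordinateRing K (rankVariety R n b r) ≃ₐ[K]
        (CoordinateRing K (varietyOfComplexes R n b) ⧸
          (minorIdeal K n b r).map
            (Ideal.Quotient.mk (vanishingIdealOfPoints K (varietyOfComplexes R n b)))),
      ∀ p : MvPolynomial (EntryIndex n b) K,
        e (Ideal.Quotient.mk (vanishingIdealOfPoints K (rankVariety R n b r)) p) =
          Ideal.Quotient.mk
            ((minorIdeal K n b r).map
              (Ideal.Quotient.mk (vanishingIdealOfPoints K (varietyOfComplexes R n b))))
            (Ideal.Quotient.mk
              (vanishingIdealOfPoints K (varietyOfComplexes R n b)) p)) := by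
  refine ⟨⟨Ideal.quotientEquivAlgOfEq K (vanishingIdeal_varietyOfComplexes hKR n b),
    fun p => rfl⟩, ?_⟩
  have h : vanishingIdealOfPoints K (rankVariety R n b r) =
      vanishingIdealOfPoints K (varietyOfComplexes R n b) ⊔ minorIdeal K n b r := by
    rw [vanishingIdeal_rankVariety hKR, vanishingIdeal_varietyOfComplexes hKR]
  exact ⟨(Ideal.quotientEquivAlgOfEq K h).trans (DoubleQuot.quotQuotEquivQuotSupₐ K _ _).symm,
    fun p => rfl⟩
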